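/- Let $i,j\ge 1$ be integers. **Non-ambiguous trees.** A (non-empty) non-ambiguous tree (NAT) of geometric size $i\times j$ is a binary tree with $i-1$ left children and $j-1$ right children, whose left (resp. right) children are labelled bijectively by $1,\dots,i-1$ (resp. $1,\dots,j-1$), such that the label of a left (resp. right) child is strictly greater than the label of each of its proper descendants that is a left (resp. right) child. The root counts as a left child labelled $i$ and as a right child labelled $j$. A vertex is placed at the point $(x,y)$, where $x$ (its row) is the label of the closest left child among the vertex and its ancestors, and $y$ (its column) that of the closest right child. Rows $i,\dots,1$ are drawn from top to bottom and columns $j,\dots,1$ from left to right. The hook of a vertex consists of the vertex, its leftmost branch and its rightmost branch; the vertices are partitioned into hooks by extracting the hook of the root and iterating on the remaining forest, and $\mathrm{hook}(T)$ is the number of hooks obtained. **Zigzag maps.** The south-east border of the rectangle consists of one horizontal edge under each column $y$, denoted by the blue integer $\mathbf{b}_y$ ($1\le y\le j$), and one vertical edge at the right end of each row $x$, denoted by the red integer $\mathbf{r}_x$ ($1\le x\le i$). For a set of points $A$, the zigzag map sends $\mathbf{r}_x$ to the border edge reached from the leftmost point of row $x$ by going alternately down and right (down first), each time to the closest point of $A$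 in the same column, resp. row; it sends $\mathbf{b}_y$ to the border edge reached from the topmost point of column $y$ by going alternately right and down (right first); the edge of a line containing no point of $A$ is fixed. Let $\psi(T)$ be the zigzag map of the set of points of $T$. Let $\varphi(T)$ be the zigzag map of the set of points of $T$ that are not in the first column $j$, where the edges are numbered from west to east and then from south to north: $\mathbf{b}_y\mapsto j-y$ for $1\le y\le j-1$ and $\mathbf{r}_x\mapsto j+x-1$ for $1\le x\le i$. **Cycles and permutations.** A 2-coloured block decreasing cycle of size $i\times j$ is a cyclic permutation $c$ of the whole set $\{\mathbf{r}_1,\dots,\mathbf{r}_i\}\cup\{\mathbf{b}_1,\dots,\mathbf{b}_j\}$ such that, whenever $c$ sends an element to an element of the same colour, the integer decreases strictly. Its blue blocks are the maximal runs of consecutive blue elements along the cycle. For a permutation $\pi$ of $\{1,\dots,i+j-1\}$ whose excedances (the $u$ with $\pi(u)>u$) are exactly $1,\dots,j-1$, the Clark–Ehrenborg statistic is $$\mathrm{CE}(\pi)=|\{u\in\{1,\dots,j-1\}:\ \pi(u)>j\}|+1 .$$ Given a 2-coloured block decreasing cycle $c$, write it as the cyclic word $\mathbf{b}_j\,B_1\cdots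 B_k\,\mathbf{r}_1\,m'$, where $B_1,\dots,B_k$ are the maximal one-coloured blocks of the factor between $\mathbf{b}_j$ and $\mathbf{r}_1$. If $k$ is even let $\omega(c)$ be the cycle $\mathbf{b}_j\,B_2B_1B_4B_3\cdots B_kB_{k-1}\,\mathbf{r}_1\,m'$, and if $k$ is odd let $\omega(c)=c$. **Statement.** The map $\psi$ is a bijection from the NATs of geometric size $i\times j$ onto the 2-coloured block decreasing cycles of size $i\times j$; the map $\varphi$ is a bijection from the NATs of geometric size $i\times j$ onto the permutations of $\{1,\dots,i+j-1\}$ whose excedances are exactly $1,\dots,j-1$; and $\omega$ is an involution on the 2-coloured block decreasing cycles of size $i\times j$. With $\Theta=\varphi\circ\psi^{-1}$, for every 2-coloured block decreasing cycle $c$ of size $i\times j$, $$\#\{\text{blue blocks of }c\}=\mathrm{CE}\bigl(\Theta(\omega(c))\bigr).$$ Consequently the hook statistic on NATs and the CE-statistic are equidistributed: for every $p$, the number of NATs of geometric size $i\times j$ with hook number $p$ equals the number of permutations of $\{1,\dots,i+j-1\}$ whose excedances are exactly $1,\dots,j-1$ and whose CE-statistic is $p$. -/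

import Mathlib

/-! ### Non-ambiguous trees -/

/-- The two kinds of child (or the two directions in a binary tree). -/
inductive Side
  | left
  | right
  deriving DecidableEq

/-- Finite, possibly empty, binary trees whose vertices carry a natural number. -/
inductive LTree
  | empty : LTree
  | node (label : ℕ) (l r : LTree) : LTree

/-- `t.labels s d`: the labels of the `s`-children in the tree `t`, whose own root is regarded as a
child on side `d`. -/
def LTree.labels (s : Side) : Side → LTree → List ℕ
  | _, .empty => []
  | d, .node a l r => (if d = s then [a] else []) ++ (labels s .left l ++ labels s .right r)

/-- In the tree `t`, whose root is a child on side `d`: if a left (resp. right) child `U` is a proper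
ancestor of a left (resp. right) child `V`, then the label of `U` is greater than that of `V`. -/
def LTree.DecreasingLabels : Side → LTree → Prop
  | _, .empty => True
  | d, .node a l r =>
      (∀ b ∈ labels d .left l ++ labels d .right r, b < a) ∧
        DecreasingLabels .left l ∧ DecreasingLabels .right r

/-- Non-empty non-ambiguous trees of geometric size `i × j`, i.e. with `i - 1` left children and
`j - 1` right children. The root has no label of its own, so the tree is given by its two labelled
subtrees. -/
@[ext]
structure NAT (i j : ℕ) where
  /-- the subtree hanging on the left of the root -/
  leftSub : LTree
  /-- the subtree hanging on the right of the root -/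
  rightSub : LTree
  card_left : (leftSub.labels .left .left ++ rightSub.labels .left .right).length + 1 = i
  card_right : (leftSub.labels .right .left ++ rightSub.labels .right .right).length + 1 = j
  /-- the labels of the left children are `1, …, i - 1`, each occurring once -/
  labels_left :
    (leftSub.labels .left .left ++ rightSub.labels .left .right).Perm (List.range' 1 (i - 1))
  /-- the labels of the right children are `1, …, j - 1`, each occurring once -/
  labels_right :
    (leftSub.labels .right .left ++ rightSub.labels .right .right).Perm (List.range' 1 (j - 1))
  decreasing_left : leftSub.DecreasingLabels .left
  decreasing_right : rightSub.DecreasingLabels .right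

/-! ### The hook number

The hook of a vertex consists of the vertex, its leftmost branch and its rightmost branch. The
partition of the vertices into hooks is obtained by extracting the hook of the root and iterating on
the trees of the remaining forest. -/

/-- Where a vertex lies in its hook. -/
inductive HookPos
  | root
  | leftBranch
  | rightBranch

/-- The number of hooks whose root belongs to the tree, given the position of the root of the tree in
its own hook. -/
def LTree.hooks : HookPos → LTree → ℕ
  | _, .empty => 0
  | .root, .node _ l r => 1 + hooks .leftBranch l + hooks .rightBranch r
  | .leftBranch, .node _ l r => hooks .leftBranch l + hooks .root r
  | .rightBranch, .node _ l r => hooks .root l + hooks .rightBranch r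

/-- The hook number of a non-ambiguous tree. -/
def NAT.hook {i j : ℕ} (T : NAT i j) : ℕ :=
  1 + T.leftSub.hooks .leftBranch + T.rightSub.hooks .rightBranch

/-! ### Geometric presentation

A vertex is placed at the point `(x, y)`: the row `x` is the label of the closest left child among
the vertex and its ancestors, the column `y` the label of the closest right child, where the root
counts as a left child labelled `i` and as a right child labelled `j`. Rows are numbered from bottom
to top and columns from right to left, so that the root is the top left point, going down decreases
`x` and going right decreases `y`. -/

/-- The points of a tree whose root is a child on side `d` of a vertex with coordinates `(x, y)`. -/
def LTree.points : Side → ℕ → ℕ → LTree → Finset (ℕ × ℕ)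
  | _, _, _, .empty => ∅
  | .left, _, y, .node a l r => insert (a, y) (points .left a y l ∪ points .right a y r)
  | .right, x, _, .node a l r => insert (x, a) (points .left x a l ∪ points .right x a r)

/-- The geometric presentation of a non-ambiguous tree. -/
def NAT.points {i j : ℕ} (T : NAT i j) : Finset (ℕ × ℕ) :=
  insert (i, j) (T.leftSub.points .left i j ∪ T.rightSub.points .right i j)

/-! ### Zigzag maps -/

/-- Coloured integers. The red integer `r` is also the vertical border edge at the east end of row
`r`, the blue integer `b` the horizontal border edge at the south end of column `b`. -/
abbrev Letter := ℕ ⊕ ℕ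

/-- The red integer `r`. -/
abbrev red (r : ℕ) : Letter := Sum.inl r

/-- The blue integer `b`. -/
abbrev blue (b : ℕ) : Letter := Sum.inr b

/-- The rows of the points of `A` in column `y`. -/
def column (A : Finset (ℕ × ℕ)) (y : ℕ) : Finset ℕ := (A.filter fun p => p.2 = y).image Prod.fst

/-- The columns of the points of `A` in row `x`. -/
def row (A : Finset (ℕ × ℕ)) (x : ℕ) : Finset ℕ := (A.filter fun p => p.1 = x).image Prod.snd

/-- The border edge reached from the point `(x, y)` by alternately going down (`Side.left`) to the
closest point of `A` in the same column and right (`Side.right`) to the closest point of `A` in the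
same row, where `d` is the direction of the first step. -/
def zigzag (A : Finset (ℕ × ℕ)) (d : Side) (x y : ℕ) : Letter :=
  match d with
  | .left =>
    if h : ((column A y).filter fun x' => x' < x).Nonempty then
      zigzag A .right (((column A y).filter fun x' => x' < x).max' h) y
    else blue y
  | .right =>
    if h : ((row A x).filter fun y' => y' < y).Nonempty then
      zigzag A .left x (((row A x).filter fun y' => y' < y).max' h)
    else red x
  termination_by x + y
  decreasing_by
    · have := Finset.max'_mem _ h
      simp only [Finset.mem_filter] at this
      omega
    · have := Finset.max'_mem _ h
      simp only [Finset.mem_filter] at this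
      omega

/-- The image of a border edge: an edge of an empty line is fixed; the zigzag of the edge of row `x`
starts downwards from the leftmost point of the row, that of the edge of column `y` starts to the
right from the topmost point of the column. -/
def edgeMap (A : Finset (ℕ × ℕ)) : Letter → Letter
  | .inl x => if h : (row A x).Nonempty then zigzag A .left x ((row A x).max' h) else red x
  | .inr y => if h : (column A y).Nonempty then zigzag A .right ((column A y).max' h) y else blue y

/-- The map `ψ(T)`, written with coloured integers. -/
def psi {i j : ℕ} (T : NAT i j) : Letter → Letter := edgeMap T.points

/-- The numbering of the south-east border from west to east and then from south to north, the edge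
of the first column `j` having number `0`. -/
def edgeNumber (j : ℕ) : Letter → ℕ
  | .inl r => j + r - 1
  | .inr b => j - b

/-- The border edge with a given number. -/
def edgeOfNumber (j u : ℕ) : Letter := if u < j then blue (j - u) else red (u - j + 1)

/-- The map `φ(T)`: the first column is deleted and the edges are numbered. -/
def phi {i j : ℕ} (T : NAT i j) (u : ℕ) : ℕ :=
  edgeNumber j (edgeMap (T.points.filter fun p => p.2 ≠ j) (edgeOfNumber j u))

/-! ### Permutations with excedances at the beginning -/

/-- The permutations of `{1, …, i + j - 1}` (seen as permutations of `ℕ` fixing all other integers)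
whose excedances are exactly `1, …, j - 1`. -/
def ExcPerm (i j : ℕ) : Type :=
  {π : Equiv.Perm ℕ // (∀ u, u ∉ Finset.Icc 1 (i + j - 1) → π u = u) ∧
    ∀ u, u < π u ↔ u ∈ Finset.Icc 1 (j - 1)}

/-- The Clark–Ehrenborg statistic. -/
def CE (j : ℕ) (π : Equiv.Perm ℕ) : ℕ := ((Finset.Icc 1 (j - 1)).filter fun u => j < π u).card + 1

/-! ### 2-coloured block decreasing cycles -/

/-- The set `{red 1, …, red i, blue 1, …, blue j}`. -/
def letters (i j : ℕ) : Finset Letter := (Finset.Icc 1 i).disjSum (Finset.Icc 1 j)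

/-- The 2-coloured block decreasing cycles of size `i × j`: the permutations consisting of a single
cycle through all the elements of `letters i j` (and fixing all other letters), in which an element
followed by an element of the same colour is greater than it. -/
def BlockCycle (i j : ℕ) : Type :=
  {c : Equiv.Perm Letter // c.IsCycle ∧ (∀ e, c e ≠ e ↔ e ∈ letters i j) ∧
    (∀ a ∈ Finset.Icc 1 i, ∀ b, c (red a) = red b → b < a) ∧
    (∀ a ∈ Finset.Icc 1 j, ∀ b, c (blue a) = blue b → b < a)}

/-- The number of blue blocks (maximal runs of blue letters) of a cycle containing both colours; every
blue block is counted through its last letter, the one that is followed by a red letter. -/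
def blueBlocks (j : ℕ) (c : Equiv.Perm Letter) : ℕ :=
  ((Finset.Icc 1 j).filter fun b => (c (blue b)).isLeft = true).card

/-- The word of length `i + j` representing a cycle on `letters i j` that begins with `blue j`. -/
def cycleWord (i j : ℕ) (c : Equiv.Perm Letter) : List Letter :=
  (List.range (i + j)).map fun k => (c ^ k) (blue j)

/-- The factorisation of a word into maximal blocks of the same colour. -/
def colourBlocks (w : List Letter) : List (List Letter) :=
  w.splitBy fun a b => a.isLeft == b.isLeft

/-- `b₁, b₂, b₃, b₄, …` becomes `b₂, b₁, b₄, b₃, …`. -/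
def swapPairs {α : Type} : List α → List α
  | a :: b :: t => b :: a :: swapPairs t
  | t => t

/-- The map `ω`: write the cycle as `(blue j) b₁ ⋯ bₖ (red 1) m'` with maximal one-coloured blocks
`b₁, …, bₖ`; if `k` is even, the result is the cycle `(blue j) b₂ b₁ ⋯ bₖ bₖ₋₁ (red 1) m'`; if `k` is
odd, the cycle is unchanged. -/
def omega (i j : ℕ) (c : Equiv.Perm Letter) : Equiv.Perm Letter :=
  let w := (cycleWord i j c).tail
  let blocks := colourBlocks (w.takeWhile fun e => e ≠ red 1)
  if Even blocks.length then
    (blue j :: ((swapPairs blocks).flatten ++ w.dropWhile fun e => e ≠ red 1)).formPerm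
  else c

/-! ### Cyclic permutations given by words -/

section FormPerm

variable {α : Type*} [DecidableEq α]

/-! Everything passes through a word attached to a tree: a left child labelled `a` with subtrees
`l`, `r` contributes the word of `r`, then `red a`, then the word of `l`; a right child contributes
the word of `l`, then `blue a`, then the word of `r`. The label of the root is the largest letter of
its colour, so cutting there recovers the tree. Decreasing trees with distinct labels thus
correspond to words without repetition in which adjacent letters of one colour decrease and the last
letter has the colour of the root (`LTree.isSideWord`, `IsSideWord.exists_tree`, `LTree.word_inj`).

A point that is leftmost in its row and topmost in its column contributes to the zigzag map the
transposition of its two border edges (`edgeMap_insert`). In preorder every point has this property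
relative to the later ones, and a transposition glues two cycles (`List.formPerm_join`), so `psi T`
is the cycle formed by `blue j` and the word of `T`. Deleting the first column drops exactly the
transpositions of the root and its leftmost branch. What remains, `LTree.foata`, is the product of
the cycles obtained by cutting the word after its right-to-left red maxima: Foata's fundamental
transformation. In the border numbering the excedance condition says that blue to blue decreases
strictly and red to red weakly; such a permutation is unravelled by peeling off the cycle of the
largest red letter (`LTree.exists_foata_eq`).

All statistics count a blue letter followed by a red one. Hooks and blue blocks count these
adjacencies in `blue j` followed by the word (`NAT.hook_eq`, `IsBlockWord.blueBlocks_eq`). Since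
`foata` sends a blue letter to its successor in the word, CE is one plus their number in the word
alone, ignoring those that end at `red 1` (`NAT.CE_excPerm`). The two counts differ only in the
factor before `red 1`, taken with its two bounding letters in one case and without them in the
other; exchanging pairs of blocks when their number is even makes the difference exactly one
(`Alternates.transitions_exchangeBlocks`). -/

theorem List.formPerm_append_cons (l : List α) (b : α) (v : List α) :
    (l ++ b :: v).formPerm = (l ++ [b]).formPerm * (b :: v).formPerm := by
  induction l with
  | nil => simp
  | cons a l ih =>
    cases l with
    | nil => simp
    | cons c l =>
      simp only [List.cons_append, List.formPerm_cons_cons] at ih ⊢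
      rw [ih, mul_assoc]

theorem List.formPerm_concat {a : α} {u : List α} (h : (a :: u).Nodup) :
    (u ++ [a]).formPerm = (a :: u).formPerm := by
  simpa using List.formPerm_rotate_one (a :: u) h

/-- Conjugating a cycle by a transposition renames its first letter. -/
theorem List.formPerm_cons_mul_swap {a b : α} {v : List α} (ha : a ∉ v) (hb : b ∉ v) :
    (a :: v).formPerm * Equiv.swap a b = Equiv.swap a b * (b :: v).formPerm := by
  cases v with
  | nil => simp
  | cons c v =>
    simp only [List.mem_cons, not_or] at ha hb
    have hc : (c :: v).formPerm * Equiv.swap a b = Equiv.swap a b * (c :: v).formPerm := by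
      have hd : Equiv.Perm.Disjoint (c :: v).formPerm (Equiv.swap a b) := by
        intro x
        by_cases hx : x ∈ c :: v
        · right
          apply Equiv.swap_apply_of_ne_of_ne <;> rintro rfl <;> simp_all
        · exact Or.inl (List.formPerm_apply_of_notMem hx)
      exact hd.commute
    rw [List.formPerm_cons_cons, List.formPerm_cons_cons, mul_assoc, hc, ← mul_assoc, ← mul_assoc]
    congr 1
    have := Equiv.mul_swap_eq_swap_mul (Equiv.swap a b) b c
    rw [Equiv.swap_apply_right, Equiv.swap_apply_of_ne_of_ne (Ne.symm ha.1) (Ne.symm hb.1)] at this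
    exact this.symm

/-- A transposition joins two cycles. -/
theorem List.formPerm_join {a b : α} {u v : List α} (h : (a :: u ++ b :: v).Nodup) :
    (a :: u ++ b :: v).formPerm = (b :: u).formPerm * (a :: v).formPerm * Equiv.swap a b := by
  have hu : (b :: a :: u).Nodup := by
    rw [List.nodup_append] at h
    refine List.nodup_cons.2 ⟨fun hb => h.2.2 b hb b (by simp) rfl, h.1⟩
  have hv : a ∉ v ∧ b ∉ v := by
    rw [List.nodup_append, List.nodup_cons (a := b)] at h
    exact ⟨fun ha => h.2.2 a (by simp) a (by simp [ha]) rfl, h.2.1.1⟩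
  simp only [List.nodup_cons, List.mem_cons, not_or] at hu
  rw [List.formPerm_append_cons, List.formPerm_concat (by simp [hu]), List.formPerm_cons_cons,
    mul_assoc (b :: u).formPerm, List.formPerm_cons_mul_swap hv.1 hv.2, ← mul_assoc,
    Equiv.swap_comm a b, List.formPerm_cons_mul_swap hu.1.2 hu.2.1]

theorem List.isChain_formPerm {a : α} {u : List α} (h : (a :: u).Nodup) :
    (a :: u ++ [a]).IsChain fun x y => (a :: u).formPerm x = y := by
  rw [List.isChain_iff_getElem]
  intro k hk
  have hk' : k < (a :: u).length := by simpa using hk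
  rw [List.getElem_append_left hk', List.formPerm_apply_getElem _ h]
  rcases Nat.lt_or_ge (k + 1) (a :: u).length with h1 | h1
  · simp only [Nat.mod_eq_of_lt h1, List.getElem_append_left h1]
  · have h2 : k + 1 = (a :: u).length := by omega
    simp [h2]

theorem List.formPerm_apply_eq_of_isChain {f : α → α} {a : α} {u : List α} (h : (a :: u).Nodup)
    (hf : (a :: u ++ [a]).IsChain fun x y => f x = y) {e : α} (he : e ∈ a :: u) :
    (a :: u).formPerm e = f e := by
  obtain ⟨k, hk, rfl⟩ := List.getElem_of_mem he
  rw [List.isChain_iff_getElem] at hf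
  have h1 := hf k (by simpa using hk)
  have h2 := List.isChain_iff_getElem.1 (List.isChain_formPerm h) k (by simpa using hk)
  rw [List.getElem_append_left hk] at h1 h2
  rw [h1, h2]

/-- Turns a condition on adjacent letters of the closed-up word into a condition on each letter and
its image; applied with `Step` for `psi` and `WeakStep` for `phi`. -/
theorem List.rel_formPerm_of_isChain {R : α → α → Prop} {a : α} {u : List α} (h : (a :: u).Nodup)
    (hR : (a :: u ++ [a]).IsChain R) {e : α} (he : e ∈ a :: u) : R e ((a :: u).formPerm e) := by
  obtain ⟨k, hk, rfl⟩ := List.getElem_of_mem he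
  have h1 := List.isChain_iff_getElem.1 hR k (by simpa using hk)
  have h2 := List.isChain_iff_getElem.1 (List.isChain_formPerm h) k (by simpa using hk)
  rw [List.getElem_append_left hk] at h1 h2
  rwa [h2]

/-- The word formed by the orbit of `a` under `f`. -/
noncomputable def orbitWord (f : Equiv.Perm α) (a : α) : List α :=
  (List.range (Function.minimalPeriod f a)).map fun k => (f ^ k) a

/-- Only the behaviour of `f` on the letters of the cycle matters, so one cycle of a larger
permutation can be read off; this gives the injectivity of `foata`. -/
theorem orbitWord_eq {f : Equiv.Perm α} {a : α} {u : List α} (h : (a :: u).Nodup)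
    (hf : ∀ e ∈ a :: u, f e = (a :: u).formPerm e) : orbitWord f a = a :: u := by
  have hlt : ∀ k, k % (a :: u).length < (a :: u).length := fun k => Nat.mod_lt _ (by simp)
  have hpow : ∀ k, (f ^ k) a = (a :: u)[k % (a :: u).length]'(hlt k) := by
    intro k
    induction k with
    | zero => simp
    | succ k ih =>
      rw [pow_succ', Equiv.Perm.mul_apply, ih, hf _ (List.getElem_mem _),
        List.formPerm_apply_getElem _ h]
      simp
  have hper : ∀ k, Function.IsPeriodicPt f k a ↔ (a :: u).length ∣ k := by
    intro k
    rw [Function.IsPeriodicPt, Function.IsFixedPt, Equiv.Perm.iterate_eq_pow, hpow,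
      Nat.dvd_iff_mod_eq_zero]
    constructor
    · intro hk
      exact (List.Nodup.getElem_inj_iff h (hi := hlt k) (hj := by simp)).1 (hk.trans (by simp))
    · intro hk
      simp [show k % (u.length + 1) = 0 by simpa using hk]
  have hmin : Function.minimalPeriod f a = (a :: u).length :=
    Nat.dvd_antisymm (((hper _).2 dvd_rfl).minimalPeriod_dvd)
      ((hper _).1 (Function.isPeriodicPt_minimalPeriod f a))
  rw [orbitWord, hmin]
  apply List.ext_getElem (by simp)
  intro k hk _
  have hk' : k < (a :: u).length := by simpa using hk
  simp only [List.getElem_map, List.getElem_range, hpow, Nat.mod_eq_of_lt hk']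

theorem orbitWord_formPerm {a : α} {u : List α} (h : (a :: u).Nodup) :
    orbitWord (a :: u).formPerm a = a :: u :=
  orbitWord_eq h fun _ _ => rfl

section

variable {f : Equiv.Perm α} {a : α}

omit [DecidableEq α] in
theorem nodup_orbitWord : (orbitWord f a).Nodup := by
  refine List.Nodup.map_on ?_ List.nodup_range
  intro k hk l hl h
  rw [List.mem_range] at hk hl
  rw [← Equiv.Perm.iterate_eq_pow, ← Equiv.Perm.iterate_eq_pow] at h
  exact Function.iterate_injOn_Iio_minimalPeriod hk hl h

omit [DecidableEq α] in
theorem orbitWord_eq_cons (ha : a ∈ Function.periodicPts f) :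
    orbitWord f a = a :: (orbitWord f a).tail := by
  have := Function.minimalPeriod_pos_of_mem_periodicPts ha
  obtain ⟨n, hn⟩ := Nat.exists_eq_succ_of_ne_zero this.ne'
  simp [orbitWord, hn, List.range_succ_eq_map]

omit [DecidableEq α] in
theorem isChain_orbitWord : (orbitWord f a ++ [a]).IsChain fun x y => f x = y := by
  rw [List.isChain_iff_getElem]
  intro k hk
  have hk' : k < (orbitWord f a).length := by simpa using hk
  rw [List.getElem_append_left hk']
  simp only [orbitWord, List.length_map, List.length_range] at hk'
  rcases Nat.lt_or_ge (k + 1) (orbitWord f a).length with h1 | h1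
  · rw [List.getElem_append_left h1]
    simp [orbitWord, pow_succ']
  · have h2 : k + 1 = (orbitWord f a).length := by
      simp only [List.length_append, List.length_singleton] at hk; omega
    simp only [h2, List.getElem_concat_length]
    have h3 : k + 1 = Function.minimalPeriod f a := by simpa [orbitWord] using h2
    have h4 : f ((f ^ k) a) = a := by
      have := Function.iterate_minimalPeriod (f := f) (x := a)
      rwa [Equiv.Perm.iterate_eq_pow, ← h3, pow_succ'] at this
    simpa [orbitWord] using h4

theorem formPerm_orbitWord_apply (ha : a ∈ Function.periodicPts f) {e : α}
    (he : e ∈ orbitWord f a) : (orbitWord f a).formPerm e = f e := by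
  have h1 := nodup_orbitWord (f := f) (a := a)
  have h2 := isChain_orbitWord (f := f) (a := a)
  rw [orbitWord_eq_cons ha] at h1 h2 he ⊢
  exact List.formPerm_apply_eq_of_isChain h1 h2 he

theorem mem_orbitWord_apply (ha : a ∈ Function.periodicPts f) {e : α} :
    f e ∈ orbitWord f a ↔ e ∈ orbitWord f a := by
  have h : ∀ e ∈ orbitWord f a, f e ∈ orbitWord f a := fun e he => by
    rw [← formPerm_orbitWord_apply ha he]
    exact List.formPerm_apply_mem_of_mem he
  refine ⟨fun he => ?_, h e⟩
  have h1 := List.formPerm_apply_mem_of_mem he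
  by_contra hne
  have h2 : ∃ x ∈ orbitWord f a, (orbitWord f a).formPerm x = f e := by
    refine ⟨(orbitWord f a).formPerm⁻¹ (f e), ?_, by simp⟩
    rw [← List.formPerm_mem_iff_mem]
    simpa using he
  obtain ⟨x, hx, hxe⟩ := h2
  rw [formPerm_orbitWord_apply ha hx] at hxe
  exact hne (f.injective hxe ▸ hx)

end

end FormPerm

/-! ### Zigzag maps as products of transpositions -/

theorem mem_column {A : Finset (ℕ × ℕ)} {x y : ℕ} : x ∈ column A y ↔ (x, y) ∈ A := by
  simp [column]

theorem mem_row {A : Finset (ℕ × ℕ)} {x y : ℕ} : y ∈ row A x ↔ (x, y) ∈ A := by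
  simp [row]

/-- `p` is neither to the right of nor below `q` on a common line. -/
def Precedes (p q : ℕ × ℕ) : Prop := (p.1 = q.1 → q.2 < p.2) ∧ (p.2 = q.2 → q.1 < p.1)

/-- A zigzag only moves down or right, while `p` lies to the left of or above every point of `A`
sharing a line with it; hence the path never meets `p`. -/
theorem zigzag_insert {A : Finset (ℕ × ℕ)} {p : ℕ × ℕ} (hp : ∀ q ∈ A, Precedes p q) (d : Side)
    (x y : ℕ) (hx : p.1 = x → y ≤ p.2) (hy : p.2 = y → x ≤ p.1) :
    zigzag (insert p A) d x y = zigzag A d x y := by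
  induction hn : x + y using Nat.strong_induction_on generalizing d x y with
  | _ n ih =>
    cases d with
    | left =>
      have h1 : (column (insert p A) y).filter (· < x) = (column A y).filter (· < x) := by
        ext z
        simp only [Finset.mem_filter, mem_column, Finset.mem_insert]
        constructor
        · rintro ⟨h | h, hz⟩
          · subst h
            have := hy rfl
            simp only at this
            omega
          · exact ⟨h, hz⟩
        · exact fun h => ⟨Or.inr h.1, h.2⟩
      rw [zigzag, zigzag]
      simp only [h1]
      split_ifs with h
      · have hm := Finset.max'_mem _ h
        simp only [Finset.mem_filter, mem_column] at hm
        have := hp _ hm.1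
        exact ih _ (by omega) .right _ y (fun h => (this.1 h).le) (fun h => (this.2 h).le) rfl
      · rfl
    | right =>
      have h1 : (row (insert p A) x).filter (· < y) = (row A x).filter (· < y) := by
        ext z
        simp only [Finset.mem_filter, mem_row, Finset.mem_insert]
        constructor
        · rintro ⟨h | h, hz⟩
          · subst h
            have := hx rfl
            simp only at this
            omega
          · exact ⟨h, hz⟩
        · exact fun h => ⟨Or.inr h.1, h.2⟩
      rw [zigzag, zigzag]
      simp only [h1]
      split_ifs with h
      · have hm := Finset.max'_mem _ h
        simp only [Finset.mem_filter, mem_row] at hm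
        have := hp _ hm.1
        exact ih _ (by omega) .left x _ (fun h => (this.1 h).le) (fun h => (this.2 h).le) rfl
      · rfl

/-- The new point starts both of its lines. The path of its row steps down from it to the former
topmost point of its column, and so continues as the old path of that column, and symmetrically. If
the old line is empty, both sides are the fixed edge. -/
theorem edgeMap_insert {A : Finset (ℕ × ℕ)} {p : ℕ × ℕ} (hp : ∀ q ∈ A, Precedes p q)
    (e : Letter) :
    edgeMap (insert p A) e = edgeMap A (Equiv.swap (red p.1) (blue p.2) e) := by
  obtain ⟨x, y⟩ := p
  have hzig : ∀ d a b, (a, b) ∈ A → zigzag (insert (x, y) A) d a b = zigzag A d a b :=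
    fun d a b h => zigzag_insert hp d a b (fun h' => ((hp _ h).1 h').le)
      (fun h' => ((hp _ h).2 h').le)
  have hlt1 : ∀ b, (x, b) ∈ A → b < y := fun b h => (hp _ h).1 rfl
  have hlt2 : ∀ a, (a, y) ∈ A → a < x := fun a h => (hp _ h).2 rfl
  rcases e with a | b
  · by_cases ha : a = x
    · subst ha
      rw [show (Sum.inl a : Letter) = red a from rfl, Equiv.swap_apply_left]
      have hne : (row (insert (a, y) A) a).Nonempty := ⟨y, mem_row.2 (by simp)⟩
      have hmax : (row (insert (a, y) A) a).max' hne = y := by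
        apply le_antisymm
        · refine Finset.max'_le _ _ _ fun z hz => ?_
          simp only [mem_row, Finset.mem_insert, Prod.mk.injEq, true_and] at hz
          rcases hz with h | h
          · omega
          · exact (hlt1 _ h).le
        · exact Finset.le_max' _ _ (mem_row.2 (by simp))
      have hf : (column (insert (a, y) A) y).filter (· < a) = column A y := by
        ext z
        simp only [Finset.mem_filter, mem_column, Finset.mem_insert, Prod.mk.injEq, and_true]
        constructor
        · rintro ⟨h | h, hz⟩
          · omega
          · exact h
        · exact fun h => ⟨Or.inr h, hlt2 _ h⟩
      simp only [edgeMap, dif_pos hne, hmax]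
      rw [zigzag]
      simp only [hf]
      split_ifs with h
      · exact hzig _ _ _ (mem_column.1 (Finset.max'_mem _ h))
      · rfl
    · rw [Equiv.swap_apply_of_ne_of_ne (by simpa using ha) (by simp)]
      have hr : row (insert (x, y) A) a = row A a := by
        ext z
        simp [mem_row, ha]
      simp only [edgeMap, hr]
      split_ifs with h
      · exact hzig _ _ _ (mem_row.1 (Finset.max'_mem _ h))
      · rfl
  · by_cases hb : b = y
    · subst hb
      rw [show (Sum.inr b : Letter) = blue b from rfl, Equiv.swap_apply_right]
      have hne : (column (insert (x, b) A) b).Nonempty := ⟨x, mem_column.2 (by simp)⟩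
      have hmax : (column (insert (x, b) A) b).max' hne = x := by
        apply le_antisymm
        · refine Finset.max'_le _ _ _ fun z hz => ?_
          simp only [mem_column, Finset.mem_insert, Prod.mk.injEq, and_true] at hz
          rcases hz with h | h
          · omega
          · exact (hlt2 _ h).le
        · exact Finset.le_max' _ _ (mem_column.2 (by simp))
      have hf : (row (insert (x, b) A) x).filter (· < b) = row A x := by
        ext z
        simp only [Finset.mem_filter, mem_row, Finset.mem_insert, Prod.mk.injEq, true_and]
        constructor
        · rintro ⟨h | h, hz⟩
          · omega
          · exact h
        · exact fun h => ⟨Or.inr h, hlt1 _ h⟩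
      simp only [edgeMap, dif_pos hne, hmax]
      rw [zigzag]
      simp only [hf]
      split_ifs with h
      · exact hzig _ _ _ (mem_row.1 (Finset.max'_mem _ h))
      · rfl
    · rw [Equiv.swap_apply_of_ne_of_ne (by simp) (by simpa using hb)]
      have hr : column (insert (x, y) A) b = column A b := by
        ext z
        simp [mem_column, hb]
      simp only [edgeMap, hr]
      split_ifs with h
      · exact hzig _ _ _ (mem_column.1 (Finset.max'_mem _ h))
      · rfl

/-- The product of the transpositions given by a list of points, the first point acting first. -/
def swapProd : List (ℕ × ℕ) → Equiv.Perm Letter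
  | [] => 1
  | p :: L => swapProd L * Equiv.swap (red p.1) (blue p.2)

theorem swapProd_append (L M : List (ℕ × ℕ)) : swapProd (L ++ M) = swapProd M * swapProd L := by
  induction L with
  | nil => simp [swapProd]
  | cons p L ih => simp [swapProd, ih, mul_assoc]

theorem edgeMap_toFinset {L : List (ℕ × ℕ)} (hL : L.Pairwise Precedes) (e : Letter) :
    edgeMap L.toFinset e = swapProd L e := by
  induction L generalizing e with
  | nil => rcases e with a | b <;> simp [edgeMap, swapProd, row, column]
  | cons p L ih =>
    rw [List.pairwise_cons] at hL
    rw [List.toFinset_cons, edgeMap_insert (by simpa using hL.1), ih hL.2, swapProd,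
      Equiv.Perm.mul_apply]

/-! ### The word of a tree -/

/-- The label of a left child is red, that of a right child blue. -/
def letter : Side → ℕ → Letter
  | .left => red
  | .right => blue

/-- The word of a tree whose root is a child on side `d`. -/
def LTree.word : Side → LTree → List Letter
  | _, .empty => []
  | .left, .node a l r => word .right r ++ red a :: word .left l
  | .right, .node a l r => word .left l ++ blue a :: word .right r

theorem LTree.mem_labels {s d : Side} {t : LTree} {b : ℕ} :
    b ∈ t.labels s d ↔ letter s b ∈ t.word d := by
  induction t generalizing d with
  | empty => simp [labels, word]
  | node a l r ihl ihr =>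
    cases d <;> cases s <;> simp [labels, word, ihl, ihr, letter] <;> tauto

theorem LTree.word_perm (d : Side) (t : LTree) :
    (t.word d).Perm ((t.labels .left d).map red ++ (t.labels .right d).map blue) := by
  rw [← Multiset.coe_eq_coe, ← Multiset.coe_add, ← Multiset.map_coe, ← Multiset.map_coe]
  induction t generalizing d with
  | empty => simp [labels, word]
  | node a l r ihl ihr =>
    cases d <;> simp only [word, labels, ← Multiset.coe_add, ← Multiset.cons_coe, ihl, ihr,
      Multiset.map_add, Multiset.map_singleton, Multiset.map_zero, Multiset.coe_nil, if_true,
      reduceCtorEq, if_false, ← Multiset.singleton_add] <;> abel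

/-- The tree is decreasing and its labels are distinct and smaller than those of the point `(x, y)`
on which it hangs. -/
structure LTree.Fits (d : Side) (x y : ℕ) (t : LTree) : Prop where
  decreasing : t.DecreasingLabels d
  nodup : (t.word d).Nodup
  lt_left : ∀ b, red b ∈ t.word d → b < x
  lt_right : ∀ b, blue b ∈ t.word d → b < y

/-- A left child moves to row `a` and stays in column `y`: decreasing labels give the new row bound,
while the column bound is inherited by both subtrees. -/
theorem LTree.Fits.left_children {x y a : ℕ} {l r : LTree} (h : (node a l r).Fits .left x y) :
    l.Fits .left a y ∧ r.Fits .right a y := by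
  obtain ⟨h1, h2, h3, h4⟩ := h
  simp only [DecreasingLabels, List.mem_append, mem_labels, letter] at h1
  simp only [word, List.nodup_append, List.nodup_cons, List.mem_append, List.mem_cons] at h2 h3 h4
  exact ⟨⟨h1.2.1, h2.2.1.2, fun b hb => h1.1 b (.inl hb), fun b hb => h4 b (.inr (.inr hb))⟩,
    ⟨h1.2.2, h2.1, fun b hb => h1.1 b (.inr hb), fun b hb => h4 b (.inl hb)⟩⟩

theorem LTree.Fits.right_children {x y a : ℕ} {l r : LTree} (h : (node a l r).Fits .right x y) :
    l.Fits .left x a ∧ r.Fits .right x a := by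
  obtain ⟨h1, h2, h3, h4⟩ := h
  simp only [DecreasingLabels, List.mem_append, mem_labels, letter] at h1
  simp only [word, List.nodup_append, List.nodup_cons, List.mem_append, List.mem_cons] at h2 h3 h4
  exact ⟨⟨h1.2.1, h2.1, fun b hb => h3 b (.inl hb), fun b hb => h1.1 b (.inl hb)⟩,
    ⟨h1.2.2, h2.2.1.2, fun b hb => h3 b (.inr (.inr hb)), fun b hb => h1.1 b (.inr hb)⟩⟩

/-- The points of a tree, listed in preorder. -/
def LTree.pointList : Side → ℕ → ℕ → LTree → List (ℕ × ℕ)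
  | _, _, _, .empty => []
  | .left, _, y, .node a l r => (a, y) :: (pointList .left a y l ++ pointList .right a y r)
  | .right, x, _, .node a l r => (x, a) :: (pointList .left x a l ++ pointList .right x a r)

theorem LTree.toFinset_pointList (d : Side) (x y : ℕ) (t : LTree) :
    (t.pointList d x y).toFinset = t.points d x y := by
  induction t generalizing d x y with
  | empty => simp [pointList, points]
  | node a l r ihl ihr => cases d <;> simp [pointList, points, ihl, ihr]

/-- Each coordinate of a point is either a label of the subtree or inherited from the vertex on
which the subtree hangs; inheritance is possible only for the line on which its root lies. -/
theorem LTree.mem_pointList {d : Side} {x y : ℕ} {t : LTree} {p : ℕ × ℕ}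
    (hp : p ∈ t.pointList d x y) :
    ((d = .right ∧ p.1 = x) ∨ red p.1 ∈ t.word d) ∧
      ((d = .left ∧ p.2 = y) ∨ blue p.2 ∈ t.word d) := by
  induction t generalizing d x y with
  | empty => simp [pointList] at hp
  | node a l r ihl ihr =>
    cases d <;> simp only [pointList, List.mem_cons, List.mem_append] at hp <;>
    · rcases hp with rfl | hp | hp
      · simp [word]
      · have := ihl hp
        simp [word] at this ⊢
        tauto
      · have := ihr hp
        simp [word] at this ⊢
        tauto

/-- The root of a subtree comes first on its two lines because labels decrease. The two subtrees
share no line: their labels are disjoint, and each inherits only one of the lines of the root, on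
which the other has no point. -/
theorem LTree.Fits.pairwise_pointList {d : Side} {x y : ℕ} {t : LTree} (h : t.Fits d x y) :
    (t.pointList d x y).Pairwise Precedes := by
  induction t generalizing d x y with
  | empty => simp [pointList]
  | node a l r ihl ihr =>
    cases d with
    | left =>
      obtain ⟨hl, hr⟩ := h.left_children
      have hn := h.nodup
      have hy := h.lt_right
      simp only [word, List.nodup_append, List.nodup_cons, List.mem_append, List.mem_cons] at hn hy
      simp only [pointList, List.pairwise_cons, List.pairwise_append, List.mem_append]
      refine ⟨?_, ihl hl, ihr hr, ?_⟩
      · rintro q (hq | hq)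
        · have := mem_pointList hq
          simp only [reduceCtorEq, false_and, false_or, true_and] at this
          have := hl.lt_left _ this.1
          exact ⟨fun h => by simp only at h; omega, fun _ => this⟩
        · have := mem_pointList hq
          simp only [reduceCtorEq, false_and, false_or, true_and] at this
          have := hr.lt_right _ this.2
          exact ⟨fun _ => this, fun h => by simp only at h; omega⟩
      · intro p hp q hq
        have h1 := mem_pointList hp
        have h2 := mem_pointList hq
        simp only [reduceCtorEq, false_and, false_or, true_and] at h1 h2
        refine ⟨fun h => ?_, fun h => ?_⟩
        · rw [← h] at h2
          rcases h2.1 with h3 | h3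
          · exact absurd (hl.lt_left _ h1.1) (by omega)
          · exact absurd rfl (hn.2.2 _ h3 _ (Or.inr h1.1))
        · rw [← h] at h2
          rcases h1.2 with h3 | h3
          · exact absurd (hr.lt_right _ h2.2) (by omega)
          · exact absurd rfl (hn.2.2 _ h2.2 _ (Or.inr h3))
    | right =>
      obtain ⟨hl, hr⟩ := h.right_children
      have hn := h.nodup
      simp only [word, List.nodup_append, List.nodup_cons, List.mem_cons] at hn
      simp only [pointList, List.pairwise_cons, List.pairwise_append, List.mem_append]
      refine ⟨?_, ihl hl, ihr hr, ?_⟩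
      · rintro q (hq | hq)
        · have := mem_pointList hq
          simp only [reduceCtorEq, false_and, false_or, true_and] at this
          have := hl.lt_left _ this.1
          exact ⟨fun h => by simp only at h; omega, fun _ => this⟩
        · have := mem_pointList hq
          simp only [reduceCtorEq, false_and, false_or, true_and] at this
          have := hr.lt_right _ this.2
          exact ⟨fun _ => this, fun h => by simp only at h; omega⟩
      · intro p hp q hq
        have h1 := mem_pointList hp
        have h2 := mem_pointList hq
        simp only [reduceCtorEq, false_and, false_or, true_and] at h1 h2
        refine ⟨fun h => ?_, fun h => ?_⟩
        · rw [← h] at h2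
          rcases h2.1 with h3 | h3
          · exact absurd (hl.lt_left _ h1.1) (by omega)
          · exact absurd rfl (hn.2.2 _ h1.1 _ (Or.inr h3))
        · rw [← h] at h2
          rcases h1.2 with h3 | h3
          · exact absurd (hr.lt_right _ h2.2) (by omega)
          · exact absurd rfl (hn.2.2 _ h3 _ (Or.inr h2.2))

/-- The line on which a point `(x, y)` has its child on side `d`. -/
def Side.line (x y : ℕ) : Side → Letter
  | .left => blue y
  | .right => red x

/-- By induction the subtrees give two cycles, one through each line of the root, and the
transposition of the root glues them. The resulting order of letters is what dictates the definition
of `LTree.word`. -/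
theorem LTree.Fits.swapProd_pointList {d : Side} {x y : ℕ} {t : LTree} (h : t.Fits d x y) :
    swapProd (t.pointList d x y) =
      (d.line x y :: t.word d).formPerm := by
  induction t generalizing d x y with
  | empty => simp [pointList, swapProd, word]
  | node a l r ihl ihr =>
    have hn := h.nodup
    cases d with
    | left =>
      have hb : blue y ∉ (node a l r).word .left := fun hb => (h.lt_right _ hb).false
      obtain ⟨hl, hr⟩ := h.left_children
      have := List.formPerm_join (List.nodup_cons.2 ⟨hb, hn⟩ :
        (blue y :: word .right r ++ red a :: word .left l).Nodup)
      simp only [List.cons_append] at this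
      simp only [pointList, swapProd, swapProd_append, ihl hl, ihr hr, word, Side.line, this]
      rw [Equiv.swap_comm]
    | right =>
      have hb : red x ∉ (node a l r).word .right := fun hb => (h.lt_left _ hb).false
      obtain ⟨hl, hr⟩ := h.right_children
      have hnd := (List.nodup_cons.2 ⟨hb, hn⟩ :
        (red x :: word .left l ++ blue a :: word .right r).Nodup)
      have := List.formPerm_join hnd
      simp only [List.cons_append] at this
      simp only [pointList, swapProd, swapProd_append, ihl hl, ihr hr, word, Side.line, this]
      -- For a right child the gluing lemma yields the two cycles in the opposite order; they
      -- commute because they are disjoint.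
      congr 1
      apply Equiv.Perm.Disjoint.commute
      intro e
      by_cases he : e ∈ red x :: word .right r
      · right
        apply List.formPerm_apply_of_notMem
        intro he'
        simp only [word, List.nodup_cons, List.nodup_append, List.mem_cons,
          List.mem_append, not_or] at hn hb he he'
        rcases he with rfl | he <;> rcases he' with he' | he'
        · simp at he'
        · exact hb.1 he'
        · subst he'
          exact hn.2.1.1 he
        · exact hn.2.2 _ he' _ (Or.inr he) rfl
      · exact Or.inl (List.formPerm_apply_of_notMem he)

/-- The product of the cycles obtained by cutting the word of a tree after its right-to-left red
maxima. -/
def LTree.foata : LTree → Equiv.Perm Letter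
  | .empty => 1
  | .node a l r => (red a :: r.word .right).formPerm * foata l

/-- Column `y` contains the root and its leftmost branch only. Dropping their transpositions leaves
the cycles of the right subtrees hanging on that branch, not glued to each other. -/
theorem LTree.Fits.swapProd_filter {x y : ℕ} {t : LTree} (h : t.Fits .left x y) :
    swapProd ((t.pointList .left x y).filter fun p => p.2 ≠ y) = t.foata := by
  suffices ∀ d x' y', t.Fits d x' y' → d = .left → y' = y →
      swapProd ((t.pointList d x' y').filter fun p => p.2 ≠ y) = t.foata from this _ _ _ h rfl rfl
  clear h
  induction t with
  | empty => simp [pointList, swapProd, foata]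
  | node a l r ihl ihr =>
    rintro _ x' y' h rfl rfl
    obtain ⟨hl, hr⟩ := h.left_children
    have h1 : (r.pointList .right a y').filter (fun p => p.2 ≠ y') = r.pointList .right a y' := by
      rw [List.filter_eq_self]
      intro p hp
      have := (mem_pointList hp).2
      simp only [reduceCtorEq, false_and, false_or] at this
      have := hr.lt_right _ this
      simp only [decide_eq_true_eq]
      omega
    rw [pointList, List.filter_cons_of_neg (by simp), List.filter_append, swapProd_append, h1,
      ihl _ _ _ hl rfl rfl, hr.swapProd_pointList, foata, Side.line]

/-! ### The words of decreasing trees -/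

/-- Consecutive letters of the same colour decrease. -/
def Step : Letter → Letter → Prop
  | .inl a, .inl b => b < a
  | .inr a, .inr b => b < a
  | _, _ => True

/-- The opposite side. -/
def Side.other : Side → Side
  | .left => .right
  | .right => .left

theorem letter_injective (d : Side) : Function.Injective (letter d) := by
  cases d
  · exact Sum.inl_injective
  · exact Sum.inr_injective

theorem exists_eq_letter (d : Side) (e : Letter) :
    (∃ a, e = letter d a) ∨ ∃ a, e = letter d.other a := by
  cases d <;> rcases e with a | a <;> simp [letter, Side.other]

theorem step_letter {d : Side} {a b : ℕ} : Step (letter d a) (letter d b) ↔ b < a := by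
  cases d <;> rfl

theorem step_letter_other (d : Side) (a b : ℕ) : Step (letter d a) (letter d.other b) := by
  cases d <;> trivial

theorem step_other_letter (d : Side) (a b : ℕ) : Step (letter d.other a) (letter d b) := by
  cases d <;> trivial

theorem exists_max_letter {d : Side} {b : ℕ} {w : List Letter} (hb : letter d b ∈ w) :
    ∃ a, letter d a ∈ w ∧ ∀ c, letter d c ∈ w → c ≤ a := by
  obtain ⟨e, he, hmax⟩ := (w.toFinset.preimage (letter d)
    (letter_injective d).injOn).exists_max_image id ⟨b, by simpa using hb⟩
  simp only [Finset.mem_preimage, List.mem_toFinset, id] at he hmax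
  exact ⟨e, he, hmax⟩

/-- The node with a child `v` on side `d` and a child `u` on the other side. -/
def LTree.join (d : Side) (a : ℕ) (u v : LTree) : LTree :=
  match d with
  | .left => .node a v u
  | .right => .node a u v

theorem LTree.join_induction {P : Side → LTree → Prop} (empty : ∀ d, P d .empty)
    (join : ∀ d a u v, P d.other u → P d v → P d (join d a u v)) (d : Side) (t : LTree) :
    P d t := by
  induction t generalizing d with
  | empty => exact empty d
  | node a l r ihl ihr =>
    cases d with
    | left => exact join .left a r l (ihr _) (ihl _)
    | right => exact join .right a l r (ihl _) (ihr _)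

theorem LTree.eq_empty_or_eq_join (d : Side) (t : LTree) :
    t = .empty ∨ ∃ a u v, t = join d a u v := by
  cases t with
  | empty => exact .inl rfl
  | node a l r =>
    cases d
    · exact .inr ⟨a, r, l, rfl⟩
    · exact .inr ⟨a, l, r, rfl⟩

theorem LTree.word_empty (d : Side) : word d .empty = [] := by
  cases d <;> rfl

theorem LTree.word_join (d : Side) (a : ℕ) (u v : LTree) :
    (join d a u v).word d = u.word d.other ++ letter d a :: v.word d := by
  cases d <;> rfl

theorem LTree.decreasingLabels_empty (d : Side) : DecreasingLabels d .empty := by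
  cases d <;> trivial

theorem LTree.decreasingLabels_join {d : Side} {a : ℕ} {u v : LTree} :
    (join d a u v).DecreasingLabels d ↔
      ((∀ b, letter d b ∈ u.word d.other → b < a) ∧ ∀ b, letter d b ∈ v.word d → b < a) ∧
        u.DecreasingLabels d.other ∧ v.DecreasingLabels d := by
  cases d
  · simp only [join, DecreasingLabels, List.mem_append, mem_labels, Side.other, letter, or_imp,
      forall_and]
    tauto
  · simp only [join, DecreasingLabels, List.mem_append, mem_labels, Side.other, letter, or_imp,
      forall_and]

/-- The words of trees whose root is a child on side `d`. -/
structure IsSideWord (d : Side) (w : List Letter) : Prop where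
  nodup : w.Nodup
  chain : w.IsChain Step
  last : ∀ e ∈ w.getLast?, ∃ b, e = letter d b

/-- Before the root label stands a word ending in the other colour, so nothing is required there;
after it, a letter of the same colour is smaller because labels decrease. -/
theorem LTree.isSideWord {d : Side} {t : LTree} (ht : t.DecreasingLabels d)
    (hn : (t.word d).Nodup) : IsSideWord d (t.word d) := by
  suffices (t.word d).IsChain Step ∧ ∀ e ∈ (t.word d).getLast?, ∃ b, e = letter d b from
    ⟨hn, this.1, this.2⟩
  induction d, t using join_induction with
  | empty d => simp [word_empty]
  | join d a u v ihu ihv =>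
    rw [decreasingLabels_join] at ht
    rw [word_join] at hn ⊢
    have hn' := hn
    rw [List.nodup_append, List.nodup_cons] at hn'
    obtain ⟨hu1, hu2⟩ := ihu ht.2.1 hn'.1
    obtain ⟨hv1, hv2⟩ := ihv ht.2.2 hn'.2.1.2
    constructor
    · rw [List.isChain_append, List.isChain_cons]
      refine ⟨hu1, ⟨fun e he => ?_, hv1⟩, fun e he e' he' => ?_⟩
      · rcases exists_eq_letter d e with ⟨b, rfl⟩ | ⟨b, rfl⟩
        · exact step_letter.2 (ht.1.2 b (List.mem_of_mem_head? he))
        · exact step_letter_other _ _ _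
      · obtain ⟨b, rfl⟩ := hu2 e he
        simp only [List.head?_cons, Option.mem_some] at he'
        exact he' ▸ step_other_letter _ _ _
    · intro e he
      rw [List.getLast?_append_of_ne_nil _ (by simp), List.getLast?_cons] at he
      cases hv : (v.word d).getLast? with
      | none => simp [hv] at he; exact ⟨a, he.symm⟩
      | some e' => simp [hv] at he; exact hv2 e (by simp [hv, he])

/-- The last letter has colour `d`, so there is a largest letter of that colour, which becomes the
root; the two sides of it are shorter words of the same kind. -/
theorem IsSideWord.exists_tree {d : Side} {w : List Letter} (hw : IsSideWord d w) :
    ∃ t : LTree, t.word d = w ∧ t.DecreasingLabels d := by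
  induction hn : w.length using Nat.strong_induction_on generalizing d w with
  | _ n ih =>
    rcases List.eq_nil_or_concat' w with rfl | ⟨w', e, rfl⟩
    · exact ⟨.empty, LTree.word_empty _, LTree.decreasingLabels_empty _⟩
    · obtain ⟨b, rfl⟩ := hw.last e (by simp)
      obtain ⟨a, ha, hmax⟩ := exists_max_letter (d := d) (b := b) (w := w' ++ [letter d b]) (by simp)
      generalize w' ++ [letter d b] = w at *
      obtain ⟨u, v, rfl⟩ := List.append_of_mem ha
      obtain ⟨h1, h2, h3⟩ := hw
      have h1' := h1
      have h2' := h2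
      rw [List.nodup_append, List.nodup_cons] at h1'
      rw [List.isChain_append, List.isChain_cons] at h2'
      simp only [List.length_append, List.length_cons] at hn
      have hu : ∀ c, letter d c ∈ u → c < a := fun c hc =>
        lt_of_le_of_ne (hmax c (by simp [hc])) fun h => h1'.2.2 _ hc (letter d a) (by simp) (h ▸ rfl)
      have hv : ∀ c, letter d c ∈ v → c < a := fun c hc =>
        lt_of_le_of_ne (hmax c (by simp [hc])) fun h => h1'.2.1.1 (h ▸ hc)
      obtain ⟨tu, hu1, hu2⟩ := ih u.length (by omega) (d := d.other) (w := u)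
        -- A letter of colour `d` just before the maximum would have to exceed it, so the left
        -- factor ends in the other colour.
        ⟨h1'.1, h2'.1, fun e he => by
          rcases exists_eq_letter d e with ⟨c, rfl⟩ | h
          · have := step_letter.1 (h2'.2.2 _ he (letter d a) (by simp))
            exact absurd (hu c (List.mem_of_mem_getLast? he)) (by omega)
          · exact h⟩ rfl
      obtain ⟨tv, hv1, hv2⟩ := ih v.length (by omega) (d := d) (w := v)
        ⟨h1'.2.1.2, h2'.2.1.2, fun e he => h3 e (by
          rw [List.getLast?_append_of_ne_nil _ (by simp), List.getLast?_cons]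
          simp_all)⟩ rfl
      refine ⟨LTree.join d a tu tv, ?_, ?_⟩
      · rw [LTree.word_join, hu1, hv1]
      · rw [LTree.decreasingLabels_join, hu1, hv1]
        exact ⟨⟨hu, hv⟩, hu2, hv2⟩

/-- Both root labels are the maximum of colour `d` in the common word, hence equal; as this letter
occurs once, the two factors around it agree as well. -/
theorem LTree.word_inj {d : Side} {t t' : LTree} (ht : t.DecreasingLabels d)
    (ht' : t'.DecreasingLabels d) (hn : (t.word d).Nodup) (h : t.word d = t'.word d) : t = t' := by
  induction d, t using join_induction generalizing t' with
  | empty d =>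
    rcases eq_empty_or_eq_join d t' with rfl | ⟨a', u', v', rfl⟩
    · rfl
    · simp [word_empty, word_join] at h
  | join d a u v ihu ihv =>
    rcases eq_empty_or_eq_join d t' with rfl | ⟨a', u', v', rfl⟩
    · simp [word_empty, word_join] at h
    · rw [decreasingLabels_join] at ht ht'
      rw [word_join] at h hn
      rw [word_join] at h
      have hn' := hn
      rw [List.nodup_append, List.nodup_cons] at hn'
      have haa : a = a' := by
        have h1 : letter d a ∈ u'.word d.other ++ letter d a' :: v'.word d := by simp [← h]
        have h2 : letter d a' ∈ u.word d.other ++ letter d a :: v.word d := by simp [h]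
        simp only [List.mem_append, List.mem_cons, (letter_injective d).eq_iff] at h1 h2
        have h3 : a ≤ a' := by
          rcases h1 with h1 | h1 | h1
          · exact (ht'.1.1 _ h1).le
          · exact h1.le
          · exact (ht'.1.2 _ h1).le
        have h4 : a' ≤ a := by
          rcases h2 with h2 | h2 | h2
          · exact (ht.1.1 _ h2).le
          · exact h2.le
          · exact (ht.1.2 _ h2).le
        omega
      subst haa
      obtain ⟨h1, -, h2⟩ := (List.append_cons_inj_of_notMem
        (fun hm => (ht.1.1 _ hm).false) (fun hm => (ht.1.2 _ hm).false)).1 h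
      rw [ihu ht.2.1 ht'.2.1 hn'.1 h1, ihv ht.2.2 ht'.2.2 hn'.2.1.2 h2]

/-! ### The words of non-ambiguous trees and of block decreasing cycles -/

/-- The words `w` such that `(blue j) w` represents a block decreasing cycle of size `i × j`. -/
structure IsBlockWord (i j : ℕ) (w : List Letter) : Prop extends IsSideWord .left w where
  red_mem : ∀ a, red a ∈ w ↔ 1 ≤ a ∧ a ≤ i
  blue_mem : ∀ b, blue b ∈ w ↔ 1 ≤ b ∧ b < j

theorem red_mem_letters {i j a : ℕ} : red a ∈ letters i j ↔ 1 ≤ a ∧ a ≤ i := by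
  simp [letters, red]

theorem blue_mem_letters {i j b : ℕ} : blue b ∈ letters i j ↔ 1 ≤ b ∧ b ≤ j := by
  simp [letters, blue]

namespace NAT

variable {i j : ℕ}

/-- The root and its subtrees, regarded as a left child in column `j`. -/
def tree (T : NAT i j) : LTree := .node i T.leftSub T.rightSub

/-- The word of a non-ambiguous tree. -/
def word (T : NAT i j) : List Letter := T.tree.word .left

theorem toFinset_pointList (T : NAT i j) :
    (T.tree.pointList .left (i + 1) j).toFinset = T.points := by
  rw [LTree.toFinset_pointList]; rfl

theorem red_mem_word (T : NAT i j) (a : ℕ) : red a ∈ T.word ↔ 1 ≤ a ∧ a ≤ i := by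
  have h1 := T.card_left
  have h2 := T.labels_left.mem_iff (a := a)
  simp only [List.mem_append, LTree.mem_labels, List.mem_range', letter] at h2
  have h3 : red a ∈ T.word ↔ a = i ∨ red a ∈ T.leftSub.word .left ∨
      red a ∈ T.rightSub.word .right := by
    simp only [word, tree, LTree.word, List.mem_append, List.mem_cons, Sum.inl.injEq]
    tauto
  rw [h3, h2]
  constructor
  · rintro (h | ⟨k, hk, h⟩) <;> omega
  · intro h
    by_cases ha : a = i
    · exact .inl ha
    · exact .inr ⟨a - 1, by omega, by omega⟩

theorem blue_mem_word (T : NAT i j) (b : ℕ) : blue b ∈ T.word ↔ 1 ≤ b ∧ b < j := by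
  have h1 := T.card_right
  have h2 := T.labels_right.mem_iff (a := b)
  simp only [List.mem_append, LTree.mem_labels, List.mem_range', letter] at h2
  have h3 : blue b ∈ T.word ↔ blue b ∈ T.leftSub.word .left ∨
      blue b ∈ T.rightSub.word .right := by
    simp only [word, tree, LTree.word, List.mem_append, List.mem_cons, reduceCtorEq, false_or]
    tauto
  rw [h3, h2]
  constructor
  · rintro ⟨k, hk, h⟩
    omega
  · intro h
    exact ⟨b - 1, by omega, by omega⟩

theorem nodup_word (T : NAT i j) : T.word.Nodup := by
  have h1 := T.card_left
  rw [word, (T.tree.word_perm .left).nodup_iff, List.nodup_append]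
  refine ⟨List.Nodup.map Sum.inl_injective ?_, List.Nodup.map Sum.inr_injective ?_, ?_⟩
  · simp only [tree, LTree.labels, if_true, List.singleton_append, List.nodup_cons]
    rw [T.labels_left.nodup_iff, T.labels_left.mem_iff]
    refine ⟨?_, List.nodup_range'⟩
    simp only [List.mem_range']
    rintro ⟨k, hk, h⟩
    omega
  · simp only [tree, LTree.labels, reduceCtorEq, if_false, List.nil_append]
    rw [T.labels_right.nodup_iff]
    exact List.nodup_range'
  · simp only [List.mem_map]
    rintro _ ⟨a, -, rfl⟩ _ ⟨b, -, rfl⟩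
    simp

theorem decreasingLabels_tree (T : NAT i j) : T.tree.DecreasingLabels .left := by
  have h1 := T.card_left
  refine ⟨fun b hb => ?_, T.decreasing_left, T.decreasing_right⟩
  rw [T.labels_left.mem_iff, List.mem_range'] at hb
  obtain ⟨k, hk, h⟩ := hb
  omega

theorem isBlockWord_word (T : NAT i j) : IsBlockWord i j T.word :=
  ⟨LTree.isSideWord T.decreasingLabels_tree T.nodup_word, T.red_mem_word, T.blue_mem_word⟩

/-- Row `i + 1` is fictitious: it makes room for the root as a left child labelled `i` in column
`j`. The word therefore contains `red i` but not `blue j`. -/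
theorem fits_tree (T : NAT i j) : T.tree.Fits .left (i + 1) j :=
  ⟨T.decreasingLabels_tree, T.nodup_word,
    fun b hb => Nat.lt_succ_of_le ((T.red_mem_word b).1 hb).2,
    fun b hb => ((T.blue_mem_word b).1 hb).2⟩

theorem word_injective : Function.Injective (word (i := i) (j := j)) := by
  intro T T' h
  have := LTree.word_inj T.decreasingLabels_tree T'.decreasingLabels_tree T.nodup_word h
  simp only [tree, LTree.node.injEq] at this
  exact NAT.ext this.2.1 this.2.2

theorem exists_tree_eq {t : LTree} (hi : 1 ≤ i) (hj : 1 ≤ j) (ht : t.DecreasingLabels .left)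
    (hw : IsBlockWord i j (t.word .left)) : ∃ T : NAT i j, T.tree = t := by
  cases t with
  | empty =>
    have := (hw.red_mem i).2 ⟨hi, le_rfl⟩
    simp [LTree.word] at this
  | node a l r =>
    have hd := ht
    simp only [LTree.DecreasingLabels, List.mem_append, LTree.mem_labels, letter] at ht
    have hr := hw.red_mem
    have hb := hw.blue_mem
    have hn := (LTree.word_perm _ _).nodup_iff.1 hw.nodup
    simp only [LTree.labels, if_true, reduceCtorEq, if_false, List.nil_append, List.map_cons, List.cons_append, List.nodup_cons] at hn
    rw [List.nodup_append] at hn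
    have hn1 := List.Nodup.of_map _ hn.2.1
    have hn2 := List.Nodup.of_map _ hn.2.2.1
    simp only [LTree.word, List.mem_append, List.mem_cons, Sum.inl.injEq, reduceCtorEq,
      false_or] at hr hb
    obtain rfl : a = i := by
      have h1 := (hr a).1 (by simp)
      rcases (hr i).2 ⟨hi, le_rfl⟩ with h | h | h
      · exact absurd (ht.1 _ (.inr h)) (by omega)
      · exact h.symm
      · exact absurd (ht.1 _ (.inl h)) (by omega)
    have hp1 : (l.labels .left .left ++ r.labels .left .right).Perm (List.range' 1 (a - 1)) := by
      rw [List.perm_ext_iff_of_nodup hn1 List.nodup_range']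
      intro b
      simp only [List.mem_append, LTree.mem_labels, letter, List.mem_range']
      constructor
      · intro h
        have h1 := (hr b).1 (by tauto)
        have h2 := ht.1 b h
        exact ⟨b - 1, by omega, by omega⟩
      · rintro ⟨k, hk, h⟩
        rcases (hr b).2 (by omega) with h' | h' | h'
        · exact .inr h'
        · omega
        · exact .inl h'
    have hp2 : (l.labels .right .left ++ r.labels .right .right).Perm (List.range' 1 (j - 1)) := by
      rw [List.perm_ext_iff_of_nodup hn2 List.nodup_range']
      intro b
      simp only [List.mem_append, LTree.mem_labels, letter, List.mem_range']
      rw [or_comm, hb]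
      constructor
      · intro h
        exact ⟨b - 1, by omega, by omega⟩
      · rintro ⟨k, hk, h⟩
        omega
    refine ⟨⟨l, r, ?_, ?_, hp1, hp2, hd.2.1, hd.2.2⟩, rfl⟩
    · rw [hp1.length_eq, List.length_range']; omega
    · rw [hp2.length_eq, List.length_range']; omega

theorem exists_word_eq {w : List Letter} (hi : 1 ≤ i) (hj : 1 ≤ j) (hw : IsBlockWord i j w) :
    ∃ T : NAT i j, T.word = w := by
  obtain ⟨t, rfl, ht⟩ := hw.toIsSideWord.exists_tree
  obtain ⟨T, rfl⟩ := exists_tree_eq hi hj ht hw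
  exact ⟨T, rfl⟩

theorem psi_eq (T : NAT i j) (e : Letter) : psi T e = (blue j :: T.word).formPerm e := by
  rw [psi, ← T.toFinset_pointList, edgeMap_toFinset T.fits_tree.pairwise_pointList,
    T.fits_tree.swapProd_pointList]
  rfl

theorem edgeMap_filter_points (T : NAT i j) (e : Letter) :
    edgeMap (T.points.filter fun p => p.2 ≠ j) e = T.tree.foata e := by
  have h : (T.points.filter fun p => p.2 ≠ j) =
      ((T.tree.pointList .left (i + 1) j).filter fun p => p.2 ≠ j).toFinset := by
    rw [← T.toFinset_pointList]
    ext p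
    simp
  rw [h, edgeMap_toFinset (T.fits_tree.pairwise_pointList.filter _), T.fits_tree.swapProd_filter]

end NAT

namespace IsBlockWord

variable {i j : ℕ} {w : List Letter}

theorem nodup_cons (hw : IsBlockWord i j w) : (blue j :: w).Nodup :=
  List.nodup_cons.2 ⟨fun h => ((hw.blue_mem j).1 h).2.false, hw.nodup⟩

theorem mem_cons (hw : IsBlockWord i j w) (hj : 1 ≤ j) (e : Letter) :
    e ∈ blue j :: w ↔ e ∈ letters i j := by
  rcases e with a | b
  · rw [red_mem_letters, ← hw.red_mem]; simp
  · rw [blue_mem_letters, List.mem_cons, hw.blue_mem, Sum.inr.injEq]; omega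

theorem length_cons (hw : IsBlockWord i j w) (hj : 1 ≤ j) : (blue j :: w).length = i + j := by
  rw [← List.toFinset_card_of_nodup hw.nodup_cons]
  have : (blue j :: w).toFinset = letters i j := by
    ext e
    rw [List.mem_toFinset, hw.mem_cons hj]
  rw [this]
  simp [letters]

theorem chain_cons (hw : IsBlockWord i j w) : (blue j :: w).IsChain Step := by
  rw [List.isChain_cons]
  refine ⟨fun e he => ?_, hw.chain⟩
  rcases e with a | b
  · trivial
  · exact ((hw.blue_mem b).1 (List.mem_of_mem_head? he)).2

/-- Closing the cycle costs nothing, since the last letter is red and `blue j` is blue. -/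
theorem chain_cons_concat (hw : IsBlockWord i j w) (hi : 1 ≤ i) :
    (blue j :: w ++ [blue j]).IsChain Step := by
  rw [List.isChain_append]
  refine ⟨hw.chain_cons, by simp, fun e he e' he' => ?_⟩
  have h1 : w ≠ [] := List.ne_nil_of_mem ((hw.red_mem 1).2 ⟨le_rfl, hi⟩)
  rw [List.getLast?_cons_of_ne_nil h1] at he
  obtain ⟨b, rfl⟩ := hw.last e he
  simp only [List.head?_cons, Option.mem_some] at he'
  subst he'
  trivial

/-- The cycle `(blue j) w`. -/
def blockCycle (hw : IsBlockWord i j w) (hi : 1 ≤ i) (hj : 1 ≤ j) : BlockCycle i j :=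
  ⟨(blue j :: w).formPerm, by
    have hlen : 2 ≤ (blue j :: w).length := by
      rw [hw.length_cons hj]; omega
    have hstep : ∀ e ∈ letters i j, Step e ((blue j :: w).formPerm e) := fun e he =>
      List.rel_formPerm_of_isChain hw.nodup_cons (hw.chain_cons_concat hi) ((hw.mem_cons hj e).2 he)
    refine ⟨List.isCycle_formPerm hw.nodup_cons hlen, fun e => ?_, fun a ha b hb => ?_,
      fun a ha b hb => ?_⟩
    · rw [← hw.mem_cons hj]
      exact ⟨List.mem_of_formPerm_apply_ne, fun he =>
        (List.formPerm_apply_mem_ne_self_iff _ hw.nodup_cons _ he).2 hlen⟩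
    · have := hstep (red a) (red_mem_letters.2 (Finset.mem_Icc.1 ha))
      rwa [hb] at this
    · have := hstep (blue a) (blue_mem_letters.2 (Finset.mem_Icc.1 ha))
      rwa [hb] at this⟩

theorem cycleWord_eq (hw : IsBlockWord i j w) (hj : 1 ≤ j) :
    cycleWord i j (blue j :: w).formPerm = blue j :: w := by
  have h1 := orbitWord_formPerm hw.nodup_cons
  have h2 := congrArg List.length h1
  rw [hw.length_cons hj] at h2
  simp only [orbitWord, List.length_map, List.length_range] at h2
  rw [← h1, h1, cycleWord, ← h2]
  exact h1

end IsBlockWord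

/-- The word is the orbit of `blue j`. Its last letter is red: a blue one would be followed by `blue
j` and hence have to exceed the largest blue letter. -/
theorem BlockCycle.exists_word {i j : ℕ} (hj : 1 ≤ j) (c : BlockCycle i j) :
    ∃ w, IsBlockWord i j w ∧ c.val = (blue j :: w).formPerm := by
  obtain ⟨c, hc, hsupp, hred, hblue⟩ := c
  simp only
  have hon : c.IsCycleOn (letters i j : Set Letter) := by
    convert hc.isCycleOn using 1
    ext e
    simp [hsupp]
  have hmem : blue j ∈ letters i j := blue_mem_letters.2 ⟨hj, le_rfl⟩
  have hper : blue j ∈ Function.periodicPts c :=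
    Function.mk_mem_periodicPts (n := (letters i j).card) (Finset.card_pos.2 ⟨_, hmem⟩) (by
      rw [Function.IsPeriodicPt, Function.IsFixedPt, Equiv.Perm.iterate_eq_pow,
        hon.pow_apply_eq hmem])
  have hword : ∀ e, e ∈ orbitWord c (blue j) ↔ e ∈ letters i j := by
    have hout : ∀ e, e ∉ letters i j → c e = e := fun e he => by
      by_contra h
      exact he ((hsupp e).1 h)
    have hstay : ∀ e, e ∈ letters i j → c e ∈ letters i j := fun e he => by
      rw [← hsupp]
      exact c.injective.ne ((hsupp e).2 he)
    have hpow : ∀ n : ℕ, (c ^ n) (blue j) ∈ letters i j ∧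
        (c ^ n) (blue j) ∈ orbitWord c (blue j) := by
      intro n
      induction n with
      | zero => exact ⟨hmem, by rw [orbitWord_eq_cons hper]; simp⟩
      | succ n ih =>
        rw [pow_succ', Equiv.Perm.mul_apply]
        exact ⟨hstay _ ih.1, (mem_orbitWord_apply hper).2 ih.2⟩
    intro e
    constructor
    · intro he
      simp only [orbitWord, List.mem_map] at he
      obtain ⟨n, -, rfl⟩ := he
      exact (hpow n).1
    · intro he
      obtain ⟨n, -, rfl⟩ := hon.exists_pow_eq hmem he
      exact (hpow n).2
  have hstep : ∀ e ∈ letters i j, Step e (c e) := by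
    rintro (a | b) he
    · cases h : c (.inl a) with
      | inl a' => exact hred a (Finset.mem_Icc.2 (red_mem_letters.1 he)) _ h
      | inr b' => trivial
    · cases h : c (.inr b) with
      | inl a' => trivial
      | inr b' => exact hblue b (Finset.mem_Icc.2 (blue_mem_letters.1 he)) _ h
  have hchain : (orbitWord c (blue j) ++ [blue j]).IsChain Step := by
    refine List.IsChain.imp_of_mem_imp (R := fun x y => c x = y) ?_ isChain_orbitWord
    rintro x y hx hy rfl
    refine hstep x ?_
    rcases List.mem_append.1 hx with h | h
    · exact (hword x).1 h
    · simp only [List.mem_singleton] at h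
      exact h ▸ hmem
  have hnodup := nodup_orbitWord (f := c) (a := blue j)
  have hform : c = (orbitWord c (blue j)).formPerm := by
    ext e : 1
    by_cases he : e ∈ orbitWord c (blue j)
    · exact (formPerm_orbitWord_apply hper he).symm
    · rw [List.formPerm_apply_of_notMem he]
      rw [hword, ← hsupp, not_not] at he
      exact he
  rw [orbitWord_eq_cons hper] at hword hchain hform hnodup
  set w := (orbitWord c (blue j)).tail
  refine ⟨w, ⟨⟨hnodup.of_cons, ?_, fun e he => ?_⟩, fun a => ?_, fun b => ?_⟩, hform⟩
  · rw [List.isChain_append, List.isChain_cons] at hchain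
    exact hchain.1.2
  · rcases e with a | b
    · exact ⟨a, rfl⟩
    · exfalso
      rw [List.isChain_append] at hchain
      have h1 : w ≠ [] := List.ne_nil_of_mem (List.mem_of_getLast? he)
      have h2 := hchain.2.2 (blue b) (by rwa [List.getLast?_cons_of_ne_nil h1]) (blue j) (by simp)
      have h3 := (hword (blue b)).1 (List.mem_cons_of_mem _ (List.mem_of_getLast? he))
      rw [blue_mem_letters] at h3
      exact absurd (show j < b from h2) (by omega)
  · rw [← red_mem_letters (j := j), ← hword]
    simp
  · have h1 := hword (blue b)
    rw [blue_mem_letters, List.mem_cons, Sum.inr.injEq] at h1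
    have h2 : blue j ∉ w := (List.nodup_cons.1 hnodup).1
    constructor
    · intro h
      have h3 := h1.1 (.inr h)
      refine ⟨h3.1, lt_of_le_of_ne h3.2 ?_⟩
      rintro rfl
      exact h2 h
    · intro h
      rcases h1.2 (by omega) with h3 | h3
      · omega
      · exact h3

/-! ### The fundamental transformation -/

/-- Blue letters followed by blue letters decrease strictly, red letters followed by red letters
weakly. -/
def WeakStep : Letter → Letter → Prop
  | .inl a, .inl b => b ≤ a
  | .inr a, .inr b => b < a
  | _, _ => True

theorem Step.weakStep {e e' : Letter} (h : Step e e') : WeakStep e e' := by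
  rcases e with a | a <;> rcases e' with b | b
  · exact le_of_lt h
  · trivial
  · trivial
  · exact h

theorem WeakStep.step {e e' : Letter} (h : WeakStep e e') (hne : e ≠ e') : Step e e' := by
  rcases e with a | a <;> rcases e' with b | b
  · exact lt_of_le_of_ne h fun hab => hne (hab ▸ rfl)
  · trivial
  · trivial
  · exact h

namespace LTree

theorem foata_apply_of_notMem {t : LTree} {e : Letter} (he : e ∉ t.word .left) :
    t.foata e = e := by
  induction t with
  | empty => rfl
  | node a l r ihl _ =>
    simp only [word, List.mem_append, List.mem_cons, not_or] at he
    rw [foata, Equiv.Perm.mul_apply, ihl he.2.2, List.formPerm_apply_of_notMem]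
    simp [he]

theorem foata_mem {t : LTree} {e : Letter} (he : e ∈ t.word .left) :
    t.foata e ∈ t.word .left := by
  by_contra h
  have h1 := t.foata.injective (foata_apply_of_notMem h)
  exact h (h1.symm ▸ he)

theorem foata_node_of_mem {a : ℕ} {l r : LTree} {e : Letter}
    (hn : ((node a l r).word .left).Nodup) (he : e ∈ red a :: r.word .right) :
    (node a l r).foata e = (red a :: r.word .right).formPerm e := by
  rw [foata, Equiv.Perm.mul_apply, foata_apply_of_notMem]
  intro h
  simp only [word, List.nodup_append, List.nodup_cons, List.mem_cons] at hn he
  rcases he with rfl | he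
  · exact hn.2.1.1 h
  · exact hn.2.2 _ he _ (.inr h) rfl

theorem foata_node_of_notMem {a : ℕ} {l r : LTree} {e : Letter}
    (hn : ((node a l r).word .left).Nodup) (he : e ∉ red a :: r.word .right) :
    (node a l r).foata e = l.foata e := by
  rw [foata, Equiv.Perm.mul_apply, List.formPerm_apply_of_notMem]
  by_cases h : e ∈ l.word .left
  · have h' := foata_mem h
    intro h''
    simp only [word, List.nodup_append, List.nodup_cons] at hn
    rcases List.mem_cons.1 h'' with h3 | h3
    · exact hn.2.1.1 (h3 ▸ h')
    · exact hn.2.2 _ h3 _ (List.mem_cons_of_mem _ h') rfl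
  · rwa [foata_apply_of_notMem h]

theorem nodup_right_of_node {a : ℕ} {l r : LTree} (hn : ((node a l r).word .left).Nodup) :
    (red a :: r.word .right).Nodup := by
  simp only [word, List.nodup_append, List.nodup_cons] at hn
  exact List.nodup_cons.2 ⟨fun h => hn.2.2 _ h (red a) (by simp) rfl, hn.1⟩

/-- Inside a block the word decreases strictly within a colour and the cycle closes from a blue
letter to the red maximum. The weak inequality is needed when the right subtree is empty: the red
letter is then fixed. -/
theorem foata_weakStep {t : LTree} (ht : t.DecreasingLabels .left) (hn : (t.word .left).Nodup)
    {e : Letter} (he : e ∈ t.word .left) : WeakStep e (t.foata e) := by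
  induction t with
  | empty => simp [word] at he
  | node a l r ihl _ =>
    have hn' := hn
    have ht' := ht
    simp only [word, List.nodup_append, List.nodup_cons] at hn'
    simp only [DecreasingLabels, List.mem_append, mem_labels, letter] at ht'
    have hr := nodup_right_of_node hn
    by_cases h : e ∈ red a :: r.word .right
    · rw [foata_node_of_mem hn h]
      refine List.rel_formPerm_of_isChain hr ?_ h
      have hside := isSideWord ht'.2.2 hn'.1
      rw [List.isChain_append, List.isChain_cons]
      refine ⟨⟨fun x hx => ?_, hside.chain.imp fun _ _ => Step.weakStep⟩, by simp,
        fun x hx y hy => ?_⟩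
      · rcases x with b | b
        · exact (ht'.1 b (.inr (List.mem_of_mem_head? hx))).le
        · trivial
      · simp only [List.head?_cons, Option.mem_some] at hy
        subst hy
        rw [List.getLast?_cons] at hx
        cases hl : (r.word .right).getLast? with
        | none =>
          simp only [hl, Option.getD_none, Option.mem_some] at hx
          subst hx
          exact le_refl a
        | some z =>
          simp only [hl, Option.getD_some, Option.mem_some] at hx
          subst hx
          obtain ⟨b, rfl⟩ := hside.last z hl
          trivial
    · rw [foata_node_of_notMem hn h]
      refine ihl ht'.2.1 hn'.2.1.2 ?_
      simp only [word, List.mem_append, List.mem_cons, not_or] at he h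
      tauto

/-- Following a blue letter in the word of a tree is the same as applying `foata`. -/
theorem isChain_foata {t : LTree} (hn : (t.word .left).Nodup) :
    (t.word .left).IsChain fun x y => x.isRight = true → t.foata x = y := by
  induction t with
  | empty => simp [word]
  | node a l r ihl _ =>
    have hn' := hn
    simp only [word, List.nodup_append, List.nodup_cons] at hn'
    have hr := nodup_right_of_node hn
    rw [word, List.isChain_split]
    constructor
    · have h1 := (List.isChain_formPerm hr).tail
      simp only [List.cons_append, List.tail_cons] at h1
      refine List.IsChain.imp_of_mem_imp ?_ h1
      rintro x y hx - h -
      rw [foata_node_of_mem hn (by simpa [or_comm] using hx), h]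
    · rw [List.isChain_cons]
      refine ⟨fun y _ h => by simp at h, ?_⟩
      refine List.IsChain.imp_of_mem_imp ?_ (ihl hn'.2.1.2)
      intro x y hx _ h hxr
      rw [foata_node_of_notMem hn, h hxr]
      intro h''
      rcases List.mem_cons.1 h'' with h3 | h3
      · exact hn'.2.1.1 (h3 ▸ hx)
      · exact hn'.2.2 _ h3 _ (List.mem_cons_of_mem _ hx) rfl

/-- The root label is the largest red letter, and its cycle, read from there, spells the word of the
right subtree. Cancelling this cycle leaves `foata` of the left subtree. -/
theorem foata_inj {t t' : LTree} (ht : t.DecreasingLabels .left)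
    (ht' : t'.DecreasingLabels .left) (hn : (t.word .left).Nodup) (hn' : (t'.word .left).Nodup)
    (hmem : ∀ e, e ∈ t.word .left ↔ e ∈ t'.word .left) (h : t.foata = t'.foata) : t = t' := by
  induction t generalizing t' with
  | empty =>
    cases t' with
    | empty => rfl
    | node a' l' r' => simpa [word] using hmem (red a')
  | node a l r ihl _ =>
    cases t' with
    | empty => simpa [word] using hmem (red a)
    | node a' l' r' =>
      have hd := ht
      have hd' := ht'
      simp only [DecreasingLabels, List.mem_append, mem_labels, letter] at hd hd'
      obtain rfl : a = a' := by
        have h1 := (hmem (red a)).1 (by simp [word])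
        have h2 := (hmem (red a')).2 (by simp [word])
        simp only [word, List.mem_append, List.mem_cons, Sum.inl.injEq] at h1 h2
        have h3 : a ≤ a' := by
          rcases h1 with h1 | h1 | h1
          · exact (hd'.1 _ (.inr h1)).le
          · exact h1.le
          · exact (hd'.1 _ (.inl h1)).le
        have h4 : a' ≤ a := by
          rcases h2 with h2 | h2 | h2
          · exact (hd.1 _ (.inr h2)).le
          · exact h2.le
          · exact (hd.1 _ (.inl h2)).le
        omega
      have hr := nodup_right_of_node hn
      have hr' := nodup_right_of_node hn'
      have ho := orbitWord_eq hr fun e he => foata_node_of_mem hn he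
      have ho' := orbitWord_eq hr' fun e he => foata_node_of_mem hn' he
      rw [h, ho'] at ho
      obtain rfl : r = r' := word_inj hd.2.2 hd'.2.2 hr.of_cons (List.cons_inj_right _ |>.1 ho).symm
      have hl : l.foata = l'.foata := by
        rw [foata, foata] at h
        exact mul_left_cancel h
      simp only [word, List.nodup_append, List.nodup_cons, List.mem_append, List.mem_cons]
        at hn hn' hmem
      rw [ihl hd.2.1 hd'.2.1 hn.2.1.2 hn'.2.1.2 (fun e => ?_) hl]
      constructor
      · intro he
        rcases (hmem e).1 (.inr (.inr he)) with h1 | h1 | h1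
        · exact absurd rfl (hn.2.2 _ h1 _ (.inr he))
        · exact absurd (h1 ▸ he) hn.2.1.1
        · exact h1
      · intro he
        rcases (hmem e).2 (.inr (.inr he)) with h1 | h1 | h1
        · exact absurd rfl (hn'.2.2 _ h1 _ (.inr he))
        · exact absurd (h1 ▸ he) hn'.2.1.1
        · exact h1

end LTree

/-! ### Recovering a tree from a permutation with weakly decreasing steps -/

theorem Equiv.Perm.apply_mem_of_fixes {α : Type*} {S : Finset α} {σ : Equiv.Perm α}
    (hS : ∀ e, e ∉ S → σ e = e) {e : α} (he : e ∈ S) : σ e ∈ S := by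
  by_contra h
  have h1 := σ.injective (hS _ h)
  exact h (h1.symm ▸ he)

theorem Equiv.Perm.pow_apply_mem_of_fixes {α : Type*} {S : Finset α} {σ : Equiv.Perm α}
    (hS : ∀ e, e ∉ S → σ e = e) {e : α} (he : e ∈ S) (n : ℕ) : (σ ^ n) e ∈ S := by
  induction n with
  | zero => exact he
  | succ n ih =>
    rw [pow_succ', Equiv.Perm.mul_apply]
    exact Equiv.Perm.apply_mem_of_fixes hS ih

theorem Equiv.Perm.mem_periodicPts_of_fixes {α : Type*} {S : Finset α} {σ : Equiv.Perm α}
    (hS : ∀ e, e ∉ S → σ e = e) {e : α} (he : e ∈ S) : e ∈ Function.periodicPts σ := by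
  obtain ⟨m, -, n, -, hne, heq⟩ := Set.infinite_univ.exists_ne_map_eq_of_mapsTo
    (f := fun n : ℕ => (σ ^ n) e) 
    (fun n _ => Equiv.Perm.pow_apply_mem_of_fixes hS he n) S.finite_toSet
  wlog hlt : m < n generalizing m n
  · exact this n m hne.symm heq.symm (by omega)
  refine Function.mk_mem_periodicPts (n := n - m) (by omega) ?_
  rw [Function.IsPeriodicPt, Function.IsFixedPt, Equiv.Perm.iterate_eq_pow]
  apply (σ ^ m).injective
  rw [← Equiv.Perm.mul_apply, ← pow_add, heq]
  congr 2
  omega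

/-- The cycle of the largest red letter, without that letter, is the word of the right subtree;
dividing `σ` by this cycle leaves a permutation of fewer letters, which gives the left subtree by
induction. -/
theorem LTree.exists_foata_eq {S : Finset Letter} {σ : Equiv.Perm Letter}
    (hS : ∀ e, e ∉ S → σ e = e) (hstep : ∀ e ∈ S, WeakStep e (σ e)) :
    ∃ t : LTree, t.DecreasingLabels .left ∧ (t.word .left).Nodup ∧
      (∀ e, e ∈ t.word .left ↔ e ∈ S) ∧ t.foata = σ := by
  induction hcard : S.card using Nat.strong_induction_on generalizing S σ with
  | _ n ih =>
    by_cases hred : ∃ b, red b ∈ S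
    · obtain ⟨b, hb⟩ := hred
      obtain ⟨a, ha, hmax⟩ := exists_max_letter (d := .left) (b := b) (w := S.toList)
        (by simpa [letter] using hb)
      simp only [letter, Finset.mem_toList] at ha hmax
      have hper := Equiv.Perm.mem_periodicPts_of_fixes hS ha
      have hnodup := nodup_orbitWord (f := σ) (a := red a)
      have hchain := isChain_orbitWord (f := σ) (a := red a)
      have happly := fun e => formPerm_orbitWord_apply (e := e) hper
      have hmem := fun e => mem_orbitWord_apply (e := e) hper
      have hsub : ∀ e ∈ orbitWord σ (red a), e ∈ S := by
        intro e he
        simp only [orbitWord, List.mem_map] at he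
        obtain ⟨n, -, rfl⟩ := he
        exact Equiv.Perm.pow_apply_mem_of_fixes hS ha n
      rw [orbitWord_eq_cons hper] at hnodup hchain happly hmem hsub
      generalize (orbitWord σ (red a)).tail = u at hnodup hchain happly hmem hsub
      have hua : red a ∉ u := (List.nodup_cons.1 hnodup).1
      have hlt : ∀ c, red c ∈ S → red c ≠ red a → c < a := fun c hc hne =>
        lt_of_le_of_ne (hmax c hc) fun h => hne (h ▸ rfl)
      have hu : IsSideWord .right u := by
        have h1 : (u ++ [red a]).IsChain fun x y => σ x = y := by simpa using hchain.tail
        rw [List.isChain_append] at h1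
        refine ⟨hnodup.of_cons, ?_, fun e he => ?_⟩
        · have h2 : u.IsChain fun x y => x ≠ y := hnodup.of_cons.isChain
          rw [List.isChain_iff_getElem] at h1 h2 ⊢
          intro k hk
          refine WeakStep.step ?_ (h2 k hk)
          rw [← h1.1 k hk]
          exact hstep _ (hsub _ (List.mem_cons_of_mem _ (List.getElem_mem _)))
        · have heu := List.mem_of_getLast? he
          -- The last letter of the cycle is sent to the maximum `red a`; a red one would be smaller
          -- than its image, against `WeakStep`.
          rcases e with c | c
          · have h2 := hstep _ (hsub _ (List.mem_cons_of_mem _ heu))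
            rw [h1.2.2 _ he (red a) (by simp)] at h2
            have h3 := hlt c (hsub _ (List.mem_cons_of_mem _ heu)) fun h => hua (h ▸ heu)
            exact absurd (show a ≤ c from h2) (by omega)
          · exact ⟨c, rfl⟩
      obtain ⟨r, hr1, hr2⟩ := hu.exists_tree
      set p := (red a :: u).formPerm with hp
      have hfix : ∀ e, e ∉ red a :: u → p⁻¹ e = e := fun e he => by
        rw [Equiv.Perm.inv_eq_iff_eq, List.formPerm_apply_of_notMem he]
      have hσ : ∀ e, e ∉ red a :: u → (p⁻¹ * σ) e = σ e := fun e he => by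
        rw [Equiv.Perm.mul_apply, hfix]
        rwa [hmem]
      obtain ⟨l, hl1, hl2, hl3, hl4⟩ := ih (S \ (red a :: u).toFinset).card (by
          rw [← hcard]
          refine Finset.card_lt_card (Finset.ssubset_iff_subset_ne.2 ⟨Finset.sdiff_subset, fun h => ?_⟩)
          have h1 := h ▸ ha
          simp at h1)
        (S := S \ (red a :: u).toFinset) (σ := p⁻¹ * σ)
        (fun e he => by
          rw [Finset.mem_sdiff, List.mem_toFinset, not_and, not_not] at he
          by_cases heu : e ∈ red a :: u
          · rw [Equiv.Perm.mul_apply, Equiv.Perm.inv_eq_iff_eq, happly e heu]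
          · rw [hσ e heu, hS]
            exact fun h => heu (he h))
        (fun e he => by
          rw [Finset.mem_sdiff, List.mem_toFinset] at he
          rw [hσ e he.2]
          exact hstep e he.1) rfl
      simp only [Finset.mem_sdiff, List.mem_toFinset, List.mem_cons, not_or] at hl3
      refine ⟨.node a l r, ⟨?_, hl1, hr2⟩, ?_, fun e => ?_, ?_⟩
      · simp only [List.mem_append, LTree.mem_labels, letter, hr1, hl3]
        rintro c (hc | hc)
        · exact hlt c hc.1 hc.2.1
        · exact hlt c (hsub _ (List.mem_cons_of_mem _ hc)) fun h => hua (h ▸ hc)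
      · rw [LTree.word, hr1, List.nodup_append, List.nodup_cons]
        refine ⟨hnodup.of_cons, ⟨fun h => ((hl3 _).1 h).2.1 rfl, hl2⟩, fun x hx y hy => ?_⟩
        rintro rfl
        rcases List.mem_cons.1 hy with rfl | hy
        · exact hua hx
        · exact ((hl3 _).1 hy).2.2 hx
      · rw [LTree.word, hr1, List.mem_append, List.mem_cons, hl3]
        constructor
        · rintro (h | rfl | h)
          · exact hsub _ (List.mem_cons_of_mem _ h)
          · exact ha
          · exact h.1
        · intro h
          tauto
      · rw [LTree.foata, hr1, hl4, ← hp, mul_inv_cancel_left]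
    · push Not at hred
      have hempty : S = ∅ := by
        by_contra hne
        -- Without red letters, the smallest blue letter would be sent to a smaller one, so `S` is
        -- empty.
        obtain ⟨e, he, hmin⟩ := S.exists_min_image (Sum.elim id id)
          (Finset.nonempty_iff_ne_empty.2 hne)
        rcases e with b | b
        · exact hred b he
        · have h1 := Equiv.Perm.apply_mem_of_fixes hS he
          have h2 := hstep _ he
          have h3 := hmin _ h1
          cases h : σ (.inr b) with
          | inl c => exact hred c (by rwa [h] at h1)
          | inr c =>
            rw [h] at h2 h3
            exact absurd (show c < b from h2) (by simpa using h3)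
      subst hempty
      refine ⟨.empty, trivial, by simp [LTree.word], by simp [LTree.word], ?_⟩
      ext e : 1
      rw [hS e (by simp)]
      rfl

/-! ### Numbering the border -/

section Numbering

variable {i j : ℕ}

theorem edgeNumber_edgeOfNumber (j u : ℕ) : edgeNumber j (edgeOfNumber j u) = u := by
  unfold edgeOfNumber
  split_ifs with h
  · show j - (j - u) = u
    omega
  · show j + (u - j + 1) - 1 = u
    omega

theorem edgeOfNumber_injective (j : ℕ) : Function.Injective (edgeOfNumber j) :=
  Function.LeftInverse.injective (edgeNumber_edgeOfNumber j)

theorem edgeOfNumber_of_lt {u : ℕ} (h : u < j) : edgeOfNumber j u = blue (j - u) := if_pos h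

theorem edgeOfNumber_of_le {u : ℕ} (h : j ≤ u) : edgeOfNumber j u = red (u - j + 1) :=
  if_neg (by omega)

/-- The letters other than that of the first column. -/
def innerLetters (i j : ℕ) : Finset Letter := (letters i j).erase (blue j)

theorem red_mem_innerLetters {a : ℕ} : red a ∈ innerLetters i j ↔ 1 ≤ a ∧ a ≤ i := by
  rw [innerLetters, Finset.mem_erase, red_mem_letters]
  simp

theorem blue_mem_innerLetters {b : ℕ} : blue b ∈ innerLetters i j ↔ 1 ≤ b ∧ b < j := by
  rw [innerLetters, Finset.mem_erase, blue_mem_letters]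
  simp only [ne_eq, Sum.inr.injEq]
  omega

theorem IsBlockWord.mem_iff {w : List Letter} (hw : IsBlockWord i j w) (e : Letter) :
    e ∈ w ↔ e ∈ innerLetters i j := by
  rcases e with a | b
  · rw [red_mem_innerLetters, hw.red_mem]
  · rw [blue_mem_innerLetters, hw.blue_mem]

theorem edgeOfNumber_edgeNumber_of_mem {e : Letter} (he : e ∈ innerLetters i j) :
    edgeOfNumber j (edgeNumber j e) = e := by
  rcases e with a | b
  · rw [red_mem_innerLetters] at he
    rw [edgeNumber, edgeOfNumber_of_le (by omega)]
    congr 1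
    omega
  · rw [blue_mem_innerLetters] at he
    rw [edgeNumber, edgeOfNumber_of_lt (by omega)]
    congr 1
    omega

theorem edgeOfNumber_mem (hi : 1 ≤ i) (hj : 1 ≤ j) {u : ℕ} :
    edgeOfNumber j u ∈ innerLetters i j ↔ u ∈ Finset.Icc 1 (i + j - 1) := by
  rw [Finset.mem_Icc]
  rcases Nat.lt_or_ge u j with h | h
  · rw [edgeOfNumber_of_lt h, blue_mem_innerLetters]
    omega
  · rw [edgeOfNumber_of_le h, red_mem_innerLetters]
    omega

theorem edgeOfNumber_edgeNumber_apply {σ : Equiv.Perm Letter}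
    (hS : ∀ e, e ∉ innerLetters i j → σ e = e) (u : ℕ) :
    edgeOfNumber j (edgeNumber j (σ (edgeOfNumber j u))) = σ (edgeOfNumber j u) := by
  by_cases h : edgeOfNumber j u ∈ innerLetters i j
  · exact edgeOfNumber_edgeNumber_of_mem (Equiv.Perm.apply_mem_of_fixes hS h)
  · rw [hS _ h, edgeNumber_edgeOfNumber]

/-- A permutation of the letters, acting on the numbers of the edges. -/
def renumber (σ : Equiv.Perm Letter) (hS : ∀ e, e ∉ innerLetters i j → σ e = e) :
    Equiv.Perm ℕ where
  toFun u := edgeNumber j (σ (edgeOfNumber j u))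
  invFun u := edgeNumber j (σ⁻¹ (edgeOfNumber j u))
  -- `edgeNumber` is not injective on all letters, so cancelling it uses that `σ` fixes everything
  -- outside the inner letters.
  left_inv u := by
    dsimp only
    rw [edgeOfNumber_edgeNumber_apply hS, ← Equiv.Perm.mul_apply, inv_mul_cancel, Equiv.Perm.one_apply,
      edgeNumber_edgeOfNumber]
  right_inv u := by
    have hS' : ∀ e, e ∉ innerLetters i j → σ⁻¹ e = e := fun e he => by
      rw [Equiv.Perm.inv_eq_iff_eq, hS e he]
    dsimp only
    rw [edgeOfNumber_edgeNumber_apply hS', ← Equiv.Perm.mul_apply, mul_inv_cancel, Equiv.Perm.one_apply,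
      edgeNumber_edgeOfNumber]

theorem renumber_fixes (hi : 1 ≤ i) (hj : 1 ≤ j) {σ : Equiv.Perm Letter}
    (hS : ∀ e, e ∉ innerLetters i j → σ e = e) {u : ℕ} (hu : u ∉ Finset.Icc 1 (i + j - 1)) :
    renumber σ hS u = u := by
  rw [← edgeOfNumber_mem hi hj] at hu
  show edgeNumber j (σ (edgeOfNumber j u)) = u
  rw [hS _ hu, edgeNumber_edgeOfNumber]

/-- Blue edges carry the smaller numbers, in reverse order, and red edges the larger ones, in
increasing order. So blue to red goes up, red to blue goes down, a decrease among blue letters is an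
excedance and a weak decrease among red ones is not. -/
theorem lt_renumber_iff (hj : 1 ≤ j) {σ : Equiv.Perm Letter}
    (hS : ∀ e, e ∉ innerLetters i j → σ e = e)
    (hstep : ∀ e ∈ innerLetters i j, WeakStep e (σ e)) (u : ℕ) :
    u < renumber σ hS u ↔ u ∈ Finset.Icc 1 (j - 1) := by
  show u < edgeNumber j (σ (edgeOfNumber j u)) ↔ _
  rw [Finset.mem_Icc]
  by_cases h : edgeOfNumber j u ∈ innerLetters i j
  · have h1 := hstep _ h
    have h2 := Equiv.Perm.apply_mem_of_fixes hS h
    rcases Nat.lt_or_ge u j with hu | hu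
    · rw [edgeOfNumber_of_lt hu] at h h1 h2 ⊢
      rw [blue_mem_innerLetters] at h
      cases hσ : σ (blue (j - u)) with
      | inl a =>
        rw [hσ, red_mem_innerLetters] at h2
        rw [edgeNumber]
        omega
      | inr b =>
        rw [hσ, blue_mem_innerLetters] at h2
        rw [hσ] at h1
        have h3 : b < j - u := h1
        rw [edgeNumber]
        omega
    · rw [edgeOfNumber_of_le hu] at h1 h2 ⊢
      cases hσ : σ (red (u - j + 1)) with
      | inl a =>
        rw [hσ] at h1
        have h3 : a ≤ u - j + 1 := h1
        rw [edgeNumber]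
        omega
      | inr b =>
        rw [hσ, blue_mem_innerLetters] at h2
        rw [edgeNumber]
        omega
  · rw [hS _ h, edgeNumber_edgeOfNumber]
    refine ⟨fun h' => (lt_irrefl _ h').elim, fun hu => ?_⟩
    rw [edgeOfNumber_of_lt (by omega), blue_mem_innerLetters] at h
    omega

/-- The permutation of the letters given by a permutation of the numbers of the edges. -/
noncomputable def unnumber (j : ℕ) (π : Equiv.Perm ℕ) : Equiv.Perm Letter :=
  -- `edgeOfNumber j` misses `red 0`, `blue 0` and the blue letters above `j`; these are left fixed.
  π.viaEmbedding ⟨edgeOfNumber j, edgeOfNumber_injective j⟩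

theorem unnumber_apply (π : Equiv.Perm ℕ) (u : ℕ) :
    unnumber j π (edgeOfNumber j u) = edgeOfNumber j (π u) :=
  π.viaEmbedding_apply ⟨edgeOfNumber j, edgeOfNumber_injective j⟩ u

theorem ExcPerm.unnumber_fixes (hi : 1 ≤ i) (hj : 1 ≤ j) (π : ExcPerm i j) {e : Letter}
    (he : e ∉ innerLetters i j) : unnumber j π.val e = e := by
  by_cases h : e ∈ Set.range (edgeOfNumber j)
  · obtain ⟨u, rfl⟩ := h
    rw [edgeOfNumber_mem hi hj] at he
    rw [unnumber_apply, π.property.1 u he]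
  · exact Equiv.Perm.viaEmbedding_apply_of_notMem _ _ _ h

theorem ExcPerm.unnumber_weakStep (π : ExcPerm i j) {e : Letter} (he : e ∈ innerLetters i j) :
    WeakStep e (unnumber j π.val e) := by
  rw [← edgeOfNumber_edgeNumber_of_mem he, unnumber_apply]
  have hexc := π.property.2 (edgeNumber j e)
  rw [Finset.mem_Icc] at hexc
  rcases e with a | b
  · rw [red_mem_innerLetters] at he
    rw [edgeNumber] at hexc ⊢
    rw [edgeOfNumber_of_le (u := j + a - 1) (by omega)]
    rcases Nat.lt_or_ge (π.val (j + a - 1)) j with h | h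
    · rw [edgeOfNumber_of_lt h]
      trivial
    · rw [edgeOfNumber_of_le h]
      show _ ≤ _
      omega
  · rw [blue_mem_innerLetters] at he
    rw [edgeNumber] at hexc ⊢
    rw [edgeOfNumber_of_lt (u := j - b) (by omega)]
    rcases Nat.lt_or_ge (π.val (j - b)) j with h | h
    · rw [edgeOfNumber_of_lt h]
      show _ < _
      omega
    · rw [edgeOfNumber_of_le h]
      trivial

end Numbering

/-! ### The two zigzag bijections -/

namespace NAT

variable {i j : ℕ}

theorem foata_fixes (T : NAT i j) {e : Letter} (he : e ∉ innerLetters i j) :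
    T.tree.foata e = e :=
  LTree.foata_apply_of_notMem (mt (T.isBlockWord_word.mem_iff e).1 he)

/-- The image of a non-ambiguous tree under `φ`. -/
def excPerm (hi : 1 ≤ i) (hj : 1 ≤ j) (T : NAT i j) : ExcPerm i j :=
  ⟨renumber (i := i) (j := j) T.tree.foata fun _ => T.foata_fixes,
    fun _ => renumber_fixes hi hj _,
    lt_renumber_iff hj _ fun e he => LTree.foata_weakStep T.decreasingLabels_tree T.nodup_word
      ((T.isBlockWord_word.mem_iff e).2 he)⟩

theorem excPerm_apply (hi : 1 ≤ i) (hj : 1 ≤ j) (T : NAT i j) (u : ℕ) :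
    (T.excPerm hi hj).val u = phi T u := by
  rw [phi, T.edgeMap_filter_points]
  rfl

theorem excPerm_bijective (hi : 1 ≤ i) (hj : 1 ≤ j) :
    Function.Bijective (excPerm (i := i) (j := j) hi hj) := by
  constructor
  · intro T T' h
    have hfoata : T.tree.foata = T'.tree.foata := by
      ext e : 1
      by_cases he : e ∈ innerLetters i j
      · have h1 : edgeNumber j (T.tree.foata (edgeOfNumber j (edgeNumber j e))) =
            edgeNumber j (T'.tree.foata (edgeOfNumber j (edgeNumber j e))) :=
          congrArg (fun π : ExcPerm i j => π.val (edgeNumber j e)) h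
        have h2 := congrArg (edgeOfNumber j) h1
        rwa [edgeOfNumber_edgeNumber_apply fun _ => T.foata_fixes,
          edgeOfNumber_edgeNumber_apply fun _ => T'.foata_fixes,
          edgeOfNumber_edgeNumber_of_mem he] at h2
      · rw [T.foata_fixes he, T'.foata_fixes he]
    have htree := LTree.foata_inj T.decreasingLabels_tree T'.decreasingLabels_tree T.nodup_word
      T'.nodup_word (fun e => (T.isBlockWord_word.mem_iff e).trans
        (T'.isBlockWord_word.mem_iff e).symm) hfoata
    exact word_injective (congrArg (LTree.word .left) htree)
  · intro π
    obtain ⟨t, ht, hn, hmem, hfoata⟩ := LTree.exists_foata_eq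
      (fun e he => π.unnumber_fixes hi hj he) (fun e he => π.unnumber_weakStep he)
    obtain ⟨T, rfl⟩ := exists_tree_eq hi hj ht ⟨LTree.isSideWord ht hn,
      fun a => by rw [hmem, red_mem_innerLetters], fun b => by rw [hmem, blue_mem_innerLetters]⟩
    refine ⟨T, Subtype.ext (Equiv.ext fun u => ?_)⟩
    show edgeNumber j (T.tree.foata (edgeOfNumber j u)) = π.val u
    rw [hfoata, unnumber_apply, edgeNumber_edgeOfNumber]

/-- The image of a non-ambiguous tree under `ψ`. -/
def blockCycle (hi : 1 ≤ i) (hj : 1 ≤ j) (T : NAT i j) : BlockCycle i j :=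
  T.isBlockWord_word.blockCycle hi hj

theorem blockCycle_apply (hi : 1 ≤ i) (hj : 1 ≤ j) (T : NAT i j) (e : Letter) :
    (T.blockCycle hi hj).val e = psi T e :=
  (T.psi_eq e).symm

theorem blockCycle_bijective (hi : 1 ≤ i) (hj : 1 ≤ j) :
    Function.Bijective (blockCycle (i := i) (j := j) hi hj) := by
  constructor
  · intro T T' h
    have h1 : (blue j :: T.word).formPerm = (blue j :: T'.word).formPerm := congrArg Subtype.val h
    have h2 := congrArg (cycleWord i j) h1
    rw [T.isBlockWord_word.cycleWord_eq hj, T'.isBlockWord_word.cycleWord_eq hj] at h2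
    exact word_injective (List.cons_inj_right _ |>.1 h2)
  · intro c
    obtain ⟨w, hw, hc⟩ := c.exists_word hj
    obtain ⟨T, rfl⟩ := exists_word_eq hi hj hw
    exact ⟨T, Subtype.ext hc.symm⟩

end NAT

/-! ### Counting colour changes -/

/-- The number of pairs of consecutive letters satisfying `P`. -/
def transitions (P : Letter → Letter → Bool) : List Letter → ℕ
  | a :: b :: l => (if P a b then 1 else 0) + transitions P (b :: l)
  | _ => 0

/-- A blue letter followed by a red one. -/
def blueRed (a b : Letter) : Bool := a.isRight && b.isLeft

/-- A blue letter followed by a red one other than `red 1`. -/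
def blueBigRed (a b : Letter) : Bool := a.isRight && (b.isLeft && decide (b ≠ red 1))

section Transitions

variable {P : Letter → Letter → Bool}

theorem transitions_append_cons (u : List Letter) (a : Letter) (v : List Letter) :
    transitions P (u ++ a :: v) = transitions P (u ++ [a]) + transitions P (a :: v) := by
  induction u with
  | nil => simp [transitions]
  | cons b u ih =>
    cases u with
    | nil => simp [transitions]
    | cons c u =>
      simp only [List.cons_append, transitions] at ih ⊢
      rw [ih, add_assoc]

/-- Each counted pair is charged to its first letter. As `P` demands a blue first letter, `f` needs
to be the successor only on blue letters, and a final letter that is not blue is never charged. -/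
theorem transitions_eq_length {f : Letter → Letter} {l : List Letter}
    (hP : ∀ a b, P a b = true → a.isRight = true)
    (hl : l.IsChain fun x y => x.isRight = true → f x = y)
    (hlast : ∀ e ∈ l.getLast?, e.isRight = false) :
    transitions P l = (l.filter fun e => P e (f e)).length := by
  induction l with
  | nil => rfl
  | cons a l ih =>
    cases l with
    | nil =>
      have : P a (f a) = false := by
        by_contra h
        have := hP _ _ (by simpa using h)
        simp [hlast a (by simp)] at this
      simp [transitions, this]
    | cons b l =>
      rw [List.isChain_cons_cons] at hl
      have h1 : P a b = P a (f a) := by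
        cases ha : a.isRight with
        | true => rw [hl.1 ha]
        | false =>
          have h2 : ∀ c, P a c = false := fun c => by
            by_contra h
            have := hP a c (by simpa using h)
            simp [ha] at this
          rw [h2, h2]
      rw [transitions, ih hl.2 (fun e he => hlast e (by rwa [List.getLast?_cons_cons])), h1]
      cases h : P a (f a) <;> simp [List.filter_cons, h, add_comm]

end Transitions

theorem IsBlockWord.last_isRight {i j : ℕ} {w : List Letter} (hw : IsBlockWord i j w) :
    ∀ e ∈ w.getLast?, e.isRight = false := by
  intro e he
  obtain ⟨b, rfl⟩ := hw.last e he
  rfl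

theorem IsBlockWord.blueBlocks_eq {i j : ℕ} {w : List Letter} (hw : IsBlockWord i j w)
    (hi : 1 ≤ i) (hj : 1 ≤ j) :
    blueBlocks j (blue j :: w).formPerm = transitions blueRed (blue j :: w) := by
  have hchain := (List.isChain_append.1 (List.isChain_formPerm hw.nodup_cons)).1
  have hne : w ≠ [] := List.ne_nil_of_mem ((hw.red_mem 1).2 ⟨le_rfl, hi⟩)
  rw [transitions_eq_length (f := (blue j :: w).formPerm)
    (fun a b h => by simp only [blueRed, Bool.and_eq_true] at h; exact h.1)
    (hchain.imp fun _ _ h _ => h)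
    (fun e he => hw.last_isRight e (by rwa [List.getLast?_cons_of_ne_nil hne] at he)),
    ← List.toFinset_card_of_nodup (hw.nodup_cons.filter _), blueBlocks,
    ← Finset.card_image_of_injective _ (Sum.inr_injective (α := ℕ))]
  congr 1
  ext e
  rw [List.mem_toFinset, List.mem_filter, hw.mem_cons hj, Finset.mem_image]
  constructor
  · rintro ⟨b, hb, rfl⟩
    rw [Finset.mem_filter, Finset.mem_Icc] at hb
    exact ⟨blue_mem_letters.2 hb.1, by simpa [blueRed] using hb.2⟩
  · rintro ⟨he, h⟩
    rcases e with a | b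
    · simp [blueRed] at h
    · refine ⟨b, ?_, rfl⟩
      rw [Finset.mem_filter, Finset.mem_Icc]
      exact ⟨blue_mem_letters.1 he, by simpa [blueRed] using h⟩

/-- The numbers `1, …, j - 1` are the inner blue letters, whose images under `foata` are their
successors in the word. Since `red r` has number `j + r - 1`, the image exceeds `j` exactly when it
is red and not `red 1`. -/
theorem NAT.CE_excPerm {i j : ℕ} (hi : 1 ≤ i) (hj : 1 ≤ j) (T : NAT i j) :
    CE j (T.excPerm hi hj).val = transitions blueBigRed T.word + 1 := by
  have hw := T.isBlockWord_word
  have hchain : T.word.IsChain fun x y => x.isRight = true → T.tree.foata x = y :=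
    LTree.isChain_foata T.nodup_word
  rw [transitions_eq_length (f := T.tree.foata)
    (fun a b h => by simp only [blueBigRed, Bool.and_eq_true] at h; exact h.1)
    hchain hw.last_isRight,
    ← List.toFinset_card_of_nodup (T.nodup_word.filter _), CE,
    ← Finset.card_image_of_injective _ (edgeOfNumber_injective j)]
  congr 2
  have key : ∀ e ∈ innerLetters i j, e.isRight = true →
      (j < edgeNumber j (T.tree.foata e) ↔ blueBigRed e (T.tree.foata e) = true) := by
    intro e he hr
    have h1 := Equiv.Perm.apply_mem_of_fixes (fun _ => T.foata_fixes) he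
    cases h2 : T.tree.foata e with
    | inl a =>
      rw [h2, red_mem_innerLetters] at h1
      simp only [edgeNumber, blueBigRed, hr, Sum.isLeft_inl, Bool.true_and, decide_eq_true_eq,
        ne_eq, Sum.inl.injEq]
      omega
    | inr b => simp [edgeNumber, blueBigRed]
  ext e
  rw [List.mem_toFinset, List.mem_filter, hw.mem_iff, Finset.mem_image]
  constructor
  · rintro ⟨u, hu, rfl⟩
    rw [Finset.mem_filter, Finset.mem_Icc] at hu
    have h1 : edgeOfNumber j u ∈ innerLetters i j := by
      rw [edgeOfNumber_mem hi hj, Finset.mem_Icc]; omega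
    exact ⟨h1, (key _ h1 (by rw [edgeOfNumber_of_lt (by omega)]; rfl)).1 hu.2⟩
  · rintro ⟨he, h⟩
    rcases e with a | b
    · simp [blueBigRed] at h
    · refine ⟨edgeNumber j (blue b), ?_, edgeOfNumber_edgeNumber_of_mem he⟩
      rw [Finset.mem_filter, Finset.mem_Icc]
      have h1 : edgeOfNumber j (edgeNumber j (blue b)) = blue b :=
        edgeOfNumber_edgeNumber_of_mem he
      refine ⟨?_, ?_⟩
      · rw [blue_mem_innerLetters] at he
        simp only [edgeNumber]
        omega
      · show j < edgeNumber j (T.tree.foata (edgeOfNumber j (edgeNumber j (blue b))))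
        rw [h1]
        exact (key _ he rfl).2 h

theorem transitions_red_cons (a : ℕ) (v : List Letter) :
    transitions blueRed (red a :: v) = transitions blueRed v := by
  cases v <;> simp [transitions, blueRed]

theorem transitions_concat_blue (b : ℕ) (u : List Letter) :
    transitions blueRed (u ++ [blue b]) = transitions blueRed u := by
  induction u with
  | nil => rfl
  | cons a u ih =>
    cases u with
    | nil => simp [transitions, blueRed]
    | cons c u =>
      simp only [List.cons_append, transitions] at ih ⊢
      rw [ih]

/-! ### Hooks -/

/-- The four contexts needed for a simultaneous induction: the word of a left child may be preceded
by a blue letter, that of a right child followed by a red one, or both preceded and followed. With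
both neighbours there is one more change of colour, which accounts for the hook containing the right
branch. -/
theorem LTree.hooks_eq (t : LTree) (a : ℕ) :
    t.hooks .leftBranch = transitions blueRed (t.word .left) ∧
    t.hooks .root = transitions blueRed (blue a :: t.word .left) ∧
    t.hooks .root = transitions blueRed (t.word .right ++ [red a]) ∧
    ∀ b, t.hooks .rightBranch + 1 = transitions blueRed (blue b :: t.word .right ++ [red a]) := by
  induction t generalizing a with
  | empty => simp [hooks, word, transitions, blueRed]
  | node c l r ihl ihr =>
    obtain ⟨hl1, hl2, -, -⟩ := ihl a
    obtain ⟨-, -, hr3, hr4⟩ := ihr c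
    refine ⟨?_, ?_, ?_, fun b => ?_⟩
    · rw [word, transitions_append_cons, transitions_red_cons, ← hr3, ← hl1, hooks]
      omega
    · rw [word, ← List.cons_append, transitions_append_cons, transitions_red_cons, ← hr4, ← hl1,
        hooks]
      omega
    · rw [word, List.append_assoc, List.cons_append, transitions_append_cons,
        transitions_concat_blue, ← List.cons_append, ← (ihr a).2.2.2, ← hl1, hooks]
      omega
    · rw [word, List.cons_append, List.append_assoc, List.cons_append, ← List.cons_append,
        transitions_append_cons, transitions_concat_blue, ← List.cons_append, ← (ihr a).2.2.2,
        ← (ihl b).2.1, hooks]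
      omega

theorem NAT.hook_eq {i j : ℕ} (T : NAT i j) :
    T.hook = transitions blueRed (blue j :: T.word) :=
  (T.tree.hooks_eq j).2.1

/-! ### Exchanging blocks -/

/-- The list consists of non-empty one-coloured words of alternating colours, the first one being
red if `s` is true. -/
def Alternates : Bool → List (List Letter) → Prop
  | _, [] => True
  | s, B :: L => B ≠ [] ∧ (∀ e ∈ B, e.isLeft = s) ∧ Alternates (!s) L

theorem exists_alternates (p : List Letter) : ∃ s L, Alternates s L ∧ L.flatten = p := by
  induction p with
  | nil => exact ⟨true, [], trivial, rfl⟩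
  | cons a p ih =>
    obtain ⟨s, L, hL, rfl⟩ := ih
    cases L with
    | nil => exact ⟨a.isLeft, [[a]], ⟨by simp, by simp, trivial⟩, rfl⟩
    | cons B L =>
      by_cases h : a.isLeft = s
      · refine ⟨s, (a :: B) :: L, ⟨by simp, ?_, hL.2.2⟩, rfl⟩
        simpa [h] using hL.2.1
      · refine ⟨!s, [a] :: B :: L, ⟨by simp, by simpa using Bool.eq_not_of_ne h, ?_⟩, rfl⟩
        rwa [Bool.not_not]

theorem Alternates.nil_notMem {s : Bool} {L : List (List Letter)} (h : Alternates s L) :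
    [] ∉ L := by
  induction L generalizing s with
  | nil => simp
  | cons B L ih => simp [ih h.2.2, h.1.symm]

theorem Alternates.isChain {s : Bool} {L : List (List Letter)} (h : Alternates s L) :
    L.IsChain fun B B' => ∀ x ∈ B, ∀ y ∈ B', x.isLeft ≠ y.isLeft := by
  induction L generalizing s with
  | nil => simp
  | cons B L ih =>
    cases L with
    | nil => simp
    | cons B' L =>
      refine List.isChain_cons_cons.2 ⟨fun x hx y hy => ?_, ih h.2.2⟩
      rw [h.2.1 x hx, h.2.2.2.1 y hy]
      simp

theorem Alternates.isLeft_eq {s : Bool} {L : List (List Letter)} (h : Alternates s L)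
    {B : List Letter} (hB : B ∈ L) {x y : Letter} (hx : x ∈ B) (hy : y ∈ B) :
    x.isLeft = y.isLeft := by
  induction L generalizing s with
  | nil => simp at hB
  | cons B' L ih =>
    rcases List.mem_cons.1 hB with rfl | hB
    · rw [h.2.1 x hx, h.2.1 y hy]
    · exact ih h.2.2 hB

theorem Alternates.colourBlocks_flatten {s : Bool} {L : List (List Letter)}
    (h : Alternates s L) : colourBlocks L.flatten = L := by
  refine List.splitBy_flatten h.nil_notMem (fun B hB => ?_) ?_
  · have h1 : B.IsChain fun _ _ => True := List.isChain_iff_getElem.2 fun _ _ => trivial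
    refine List.IsChain.imp_of_mem_imp (fun x y hx hy _ => ?_) h1
    simp [h.isLeft_eq hB hx hy]
  · refine List.IsChain.imp_of_mem_imp (fun B B' hB hB' hne => ?_) h.isChain
    refine ⟨ne_of_mem_of_not_mem hB h.nil_notMem, ne_of_mem_of_not_mem hB' h.nil_notMem, ?_⟩
    simpa using hne _ (List.getLast_mem _) _ (List.head_mem _)

/-- A change of colour imposes no inequality, so the blocks can be reordered freely as long as the
colours still alternate. -/
theorem Alternates.isChain_step_flatten {s : Bool} {L : List (List Letter)}
    (h : Alternates s L) : L.flatten.IsChain Step ↔ ∀ B ∈ L, B.IsChain Step := by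
  rw [List.isChain_flatten h.nil_notMem, and_iff_left]
  refine h.isChain.imp fun B B' hne x hx y hy => ?_
  have := hne x (List.mem_of_getLast? hx) y (List.mem_of_head? hy)
  rcases x with a | a <;> rcases y with b | b <;> trivial

section SwapPairs

variable {α : Type}

theorem swapPairs_perm (L : List α) : (swapPairs L).Perm L := by
  induction L using swapPairs.induct with
  | case1 a b t ih => exact (List.Perm.swap a b _).trans ((ih.cons b).cons a)
  | case2 t h => rw [swapPairs]; exact h

theorem swapPairs_swapPairs (L : List α) : swapPairs (swapPairs L) = L := by
  induction L using swapPairs.induct with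
  | case1 a b t ih => simp [swapPairs, ih]
  | case2 t h =>
    have h1 : swapPairs t = t := by rw [swapPairs]; exact h
    rw [h1, h1]

end SwapPairs

/-- Parity matters: with an odd number of blocks, at least three, the unpaired last one would follow
a block of its own colour. -/
theorem Alternates.swapPairs {s : Bool} {L : List (List Letter)} (h : Alternates s L)
    (hL : Even L.length) : Alternates (!s) (swapPairs L) := by
  induction L using swapPairs.induct with
  | case1 a b t ih =>
    obtain ⟨ha, ha', hb, hb', ht⟩ := h
    rw [Bool.not_not] at ht
    refine ⟨hb, hb', ha, by simpa using ha', ?_⟩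
    rw [Bool.not_not]
    exact ih ht (by simpa [Nat.even_add_one] using hL)
  | case2 t h' =>
    rcases t with _ | ⟨a, _ | ⟨b, t⟩⟩
    · trivial
    · simp at hL
    · exact absurd rfl (h' a b t)

theorem transitions_monochrome {s : Bool} {B : List Letter} (hB : B ≠ [])
    (h : ∀ e ∈ B, e.isLeft = s) (c : Letter) (v : List Letter) :
    transitions blueRed (B ++ c :: v) =
      (if s = false ∧ c.isLeft = true then 1 else 0) + transitions blueRed (c :: v) := by
  induction B with
  | nil => exact absurd rfl hB
  | cons a B ih =>
    cases B with
    | nil =>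
      have := h a (by simp)
      rcases a with a | a <;> rcases c with c | c <;> cases s <;>
        simp_all [transitions, blueRed]
    | cons b B =>
      have ha := h a (by simp)
      have hb := h b (by simp)
      have h1 : blueRed a b = false := by
        rcases a with a | a <;> rcases b with b | b <;> cases s <;> simp_all [blueRed]
      rw [List.cons_append, List.cons_append, transitions, h1, ← List.cons_append,
        ih (by simp) fun e he => h e (List.mem_cons_of_mem _ he)]
      simp

theorem transitions_eq_zero {s : Bool} {B : List Letter} (h : ∀ e ∈ B, e.isLeft = s) :
    transitions blueRed B = 0 := by
  induction B with
  | nil => rfl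
  | cons a B ih =>
    cases B with
    | nil => rfl
    | cons b B =>
      have ha := h a (by simp)
      have hb := h b (by simp)
      rw [transitions, ih fun e he => h e (List.mem_cons_of_mem _ he)]
      rcases a with a | a <;> rcases b with b | b <;> cases s <;> simp_all [blueRed]

theorem Alternates.flatten_eq_cons {s : Bool} {B : List Letter} {L : List (List Letter)}
    (h : Alternates s (B :: L)) : ∃ c v, (B :: L).flatten = c :: v ∧ c.isLeft = s := by
  obtain ⟨hB, hs, -⟩ := h
  cases B with
  | nil => exact absurd rfl hB
  | cons c B => exact ⟨c, B ++ L.flatten, rfl, hs c (by simp)⟩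

/-- Counts the blue blocks other than a final one. Truncated subtraction takes care of the empty
list. -/
theorem Alternates.transitions_flatten {s : Bool} {L : List (List Letter)} (h : Alternates s L) :
    transitions blueRed L.flatten = if s then (L.length - 1) / 2 else L.length / 2 := by
  induction L generalizing s with
  | nil => simp [transitions]
  | cons B L ih =>
    cases L with
    | nil =>
      simp only [List.flatten_cons, List.flatten_nil, List.append_nil]
      rw [transitions_eq_zero h.2.1]
      simp
    | cons B' L =>
      obtain ⟨c, v, hcv, hc⟩ := h.2.2.flatten_eq_cons
      have h1 := ih h.2.2
      rw [List.flatten_cons, hcv, transitions_monochrome h.1 h.2.1, ← hcv, h1, hc]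
      cases s <;> simp <;> omega

theorem Alternates.transitions_flatten_concat {s : Bool} {L : List (List Letter)}
    (h : Alternates s L) (a : ℕ) : transitions blueRed (L.flatten ++ [red a]) =
      if s then L.length / 2 else (L.length + 1) / 2 := by
  induction L generalizing s with
  | nil => simp [transitions]
  | cons B L ih =>
    have h1 := ih h.2.2
    rw [List.flatten_cons, List.append_assoc]
    cases L with
    | nil =>
      rw [List.flatten_nil, List.nil_append, transitions_monochrome h.1 h.2.1]
      cases s <;> simp [transitions]
    | cons B' L =>
      obtain ⟨c, v, hcv, hc⟩ := h.2.2.flatten_eq_cons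
      rw [hcv, List.cons_append] at h1 ⊢
      rw [transitions_monochrome h.1 h.2.1, h1, hc]
      cases s <;> simp <;> omega

/-- If the first block is red or there is no block, `blue b` is a blue block by itself; otherwise it
merges with the first block. -/
theorem Alternates.transitions_cons_flatten_concat {s : Bool} {L : List (List Letter)}
    (h : Alternates s L) (a b : ℕ) : transitions blueRed (blue b :: L.flatten ++ [red a]) =
      if s ∨ L = [] then L.length / 2 + 1 else (L.length + 1) / 2 := by
  have h1 := h.transitions_flatten_concat a
  cases L with
  | nil => simp [transitions, blueRed]
  | cons B L =>
    obtain ⟨c, v, hcv, hc⟩ := h.flatten_eq_cons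
    rw [hcv] at h1 ⊢
    rw [List.cons_append, List.cons_append, transitions, ← List.cons_append, h1]
    cases s <;> rcases c with c | c <;> simp_all [blueRed] <;> omega

theorem transitions_blueBigRed_cons (a : Letter) {v : List Letter} (h : red 1 ∉ v) :
    transitions blueBigRed (a :: v) = transitions blueRed (a :: v) := by
  induction v generalizing a with
  | nil => rfl
  | cons b v ih =>
    rw [List.mem_cons, not_or] at h
    have h1 : blueBigRed a b = blueRed a b := by
      simp [blueBigRed, blueRed, Ne.symm h.1]
    rw [transitions, transitions, ih b h.2, h1]

theorem transitions_blueBigRed_concat {p : List Letter} (h : red 1 ∉ p) :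
    transitions blueBigRed (p ++ [red 1]) = transitions blueRed p := by
  induction p with
  | nil => rfl
  | cons a p ih =>
    rw [List.mem_cons, not_or] at h
    cases p with
    | nil => simp [transitions, blueBigRed]
    | cons b p =>
      have h1 : blueBigRed a b = blueRed a b := by
        simp only [List.mem_cons, not_or] at h
        simp [blueBigRed, blueRed, Ne.symm h.2.1]
      have h2 := ih h.2
      simp only [List.cons_append, transitions] at h2 ⊢
      rw [h2, h1]

/-- Isolates what differs between the two statistics: the suffix starting at `red 1` contributes the
same amount to both. -/
theorem transitions_eq_of_factor {p m : List Letter} {b : ℕ} (hp : red 1 ∉ p) (hm : red 1 ∉ m) :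
    transitions blueRed (blue b :: (p ++ red 1 :: m)) =
        transitions blueRed (blue b :: p ++ [red 1]) + transitions blueRed (red 1 :: m) ∧
      transitions blueBigRed (p ++ red 1 :: m) =
        transitions blueRed p + transitions blueRed (red 1 :: m) := by
  constructor
  · rw [← List.cons_append, transitions_append_cons]
  · rw [transitions_append_cons, transitions_blueBigRed_concat hp, transitions_blueBigRed_cons _ hm]

/-- The list of blocks after the exchange, which takes place if their number is even. -/
def exchangeBlocks (L : List (List Letter)) : List (List Letter) :=
  if Even L.length then swapPairs L else L

theorem exchangeBlocks_perm (L : List (List Letter)) : (exchangeBlocks L).Perm L := by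
  unfold exchangeBlocks
  split_ifs
  · exact swapPairs_perm L
  · exact .refl L

theorem exchangeBlocks_exchangeBlocks (L : List (List Letter)) :
    exchangeBlocks (exchangeBlocks L) = L := by
  by_cases h : Even L.length
  · have h1 : exchangeBlocks L = swapPairs L := if_pos h
    have h2 : Even (swapPairs L).length := by rwa [(swapPairs_perm L).length_eq]
    rw [h1, exchangeBlocks, if_pos h2, swapPairs_swapPairs]
  · have h1 : exchangeBlocks L = L := if_neg h
    rw [h1, h1]

theorem Alternates.exchangeBlocks {s : Bool} {L : List (List Letter)} (h : Alternates s L) :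
    Alternates (s ^^ decide (Even L.length)) (exchangeBlocks L) := by
  unfold _root_.exchangeBlocks
  split_ifs with hL
  · simpa [hL] using h.swapPairs hL
  · simpa [hL] using h

/-- Let `k` be the number of blocks. For odd `k` the two bounding letters always add one transition.
For even `k > 0` they add one if the first block is red and none if it is blue; exchanging pairs
reverses the colours and shifts the inner count by one, which restores the difference. -/
theorem Alternates.transitions_exchangeBlocks {s : Bool} {L : List (List Letter)}
    (h : Alternates s L) (b : ℕ) :
    transitions blueRed (blue b :: L.flatten ++ [red 1]) =
      transitions blueRed (_root_.exchangeBlocks L).flatten + 1 := by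
  have hlen := (exchangeBlocks_perm L).length_eq
  rw [h.transitions_cons_flatten_concat, h.exchangeBlocks.transitions_flatten, hlen]
  rcases Nat.even_or_odd L.length with hL | hL
  · rcases L with _ | ⟨B, L⟩
    · cases s <;> simp
    · obtain ⟨k, hk⟩ := hL
      have hL' : Even (B :: L).length := ⟨k, hk⟩
      rw [List.length_cons] at hk
      cases s <;> simp [hL', -List.length_cons] <;> rw [List.length_cons] <;> omega
  · have hL' := Nat.not_even_iff_odd.2 hL
    obtain ⟨k, hk⟩ := hL
    have hne : L ≠ [] := by rintro rfl; simp at hk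
    cases s <;> simp [hL', hne] <;> omega

/-! ### The involution on block words and on cycles -/

namespace IsBlockWord

variable {i j : ℕ} {w : List Letter}

theorem exists_factor (hw : IsBlockWord i j w) (hi : 1 ≤ i) :
    ∃ s L m, Alternates s L ∧ red 1 ∉ L.flatten ∧ red 1 ∉ m ∧ w = L.flatten ++ red 1 :: m := by
  obtain ⟨p, m, rfl⟩ := List.append_of_mem ((hw.red_mem 1).2 ⟨le_rfl, hi⟩)
  obtain ⟨s, L, hL, rfl⟩ := exists_alternates p
  have hn := hw.nodup
  rw [List.nodup_append, List.nodup_cons] at hn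
  exact ⟨s, L, m, hL, fun h => hn.2.2 _ h (red 1) (by simp) rfl, hn.2.1.1, rfl⟩

/-- The blocks themselves are unchanged and still alternate. Whatever block comes to stand before
`red 1` is harmless, since its red letters exceed 1; nor can a blue letter at the front conflict
with `blue j`. -/
theorem exchange {s : Bool} {L : List (List Letter)} {m : List Letter} (hL : Alternates s L)
    (hp : red 1 ∉ L.flatten) (hw : IsBlockWord i j (L.flatten ++ red 1 :: m)) :
    IsBlockWord i j ((exchangeBlocks L).flatten ++ red 1 :: m) := by
  have hperm : ((exchangeBlocks L).flatten ++ red 1 :: m).Perm (L.flatten ++ red 1 :: m) :=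
    (exchangeBlocks_perm L).flatten.append_right _
  refine ⟨⟨hperm.nodup_iff.2 hw.nodup, ?_, fun e he => hw.last e ?_⟩, fun a => ?_, fun b => ?_⟩
  · have hc := hw.chain
    rw [List.isChain_append] at hc ⊢
    refine ⟨hL.exchangeBlocks.isChain_step_flatten.2 fun B hB =>
      hL.isChain_step_flatten.1 hc.1 B ((exchangeBlocks_perm L).mem_iff.1 hB), hc.2.1,
      fun x hx y hy => ?_⟩
    simp only [List.head?_cons, Option.mem_some] at hy
    subst hy
    have hx' := (exchangeBlocks_perm L).flatten.mem_iff.1 (List.mem_of_getLast? hx)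
    rcases x with a | b
    · have h1 := (hw.red_mem a).1 (List.mem_append_left _ hx')
      refine lt_of_le_of_ne h1.1 ?_
      rintro rfl
      exact hp hx'
    · trivial
  · rw [List.getLast?_append_of_ne_nil _ (by simp)] at he ⊢
    exact he
  · rw [hperm.mem_iff, hw.red_mem]
  · rw [hperm.mem_iff, hw.blue_mem]

theorem omega_eq {s : Bool} {L : List (List Letter)} {m : List Letter} (hL : Alternates s L)
    (hp : red 1 ∉ L.flatten) (hw : IsBlockWord i j (L.flatten ++ red 1 :: m)) (hj : 1 ≤ j) :
    omega i j (blue j :: (L.flatten ++ red 1 :: m)).formPerm =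
      (blue j :: ((exchangeBlocks L).flatten ++ red 1 :: m)).formPerm := by
  have h1 : ∀ e ∈ L.flatten, decide (e ≠ red 1) = true := fun e he => by
    rw [decide_eq_true_eq]
    rintro rfl
    exact hp he
  have h2 : (L.flatten ++ red 1 :: m).takeWhile (fun e => e ≠ red 1) = L.flatten := by
    rw [List.takeWhile_append_of_pos h1]
    simp
  have h3 : (L.flatten ++ red 1 :: m).dropWhile (fun e => e ≠ red 1) = red 1 :: m := by
    rw [List.dropWhile_append_of_pos h1]
    simp
  rw [omega]
  simp only [hw.cycleWord_eq hj, List.tail_cons, h2, h3, hL.colourBlocks_flatten]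
  rw [exchangeBlocks]
  split_ifs <;> rfl

end IsBlockWord

namespace BlockCycle

variable {i j : ℕ}

/-- Collects, for a single factorisation at `red 1`, the validity of the exchange, its involutivity
and its effect on the statistics. -/
theorem exists_omega_eq (hi : 1 ≤ i) (hj : 1 ≤ j) (c : BlockCycle i j) :
    ∃ w w', IsBlockWord i j w ∧ IsBlockWord i j w' ∧ c.val = (blue j :: w).formPerm ∧
      omega i j c.val = (blue j :: w').formPerm ∧ omega i j (blue j :: w').formPerm = c.val ∧
      transitions blueRed (blue j :: w) = transitions blueBigRed w' + 1 := by
  obtain ⟨w, hw, hc⟩ := c.exists_word hj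
  obtain ⟨s, L, m, hL, hp, hm, rfl⟩ := hw.exists_factor hi
  have hp' : red 1 ∉ (exchangeBlocks L).flatten :=
    fun h => hp ((exchangeBlocks_perm L).flatten.mem_iff.1 h)
  refine ⟨_, _, hw, hw.exchange hL hp, hc, ?_, ?_, ?_⟩
  · rw [hc, hw.omega_eq hL hp hj]
  · rw [(hw.exchange hL hp).omega_eq hL.exchangeBlocks hp' hj, exchangeBlocks_exchangeBlocks, hc]
  · rw [(transitions_eq_of_factor hp hm).1, (transitions_eq_of_factor (b := j) hp' hm).2,
      hL.transitions_exchangeBlocks]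
    omega

/-- The involution `ω` on block decreasing cycles. -/
def exchange (hi : 1 ≤ i) (hj : 1 ≤ j) (c : BlockCycle i j) : BlockCycle i j :=
  ⟨omega i j c.val, by
    obtain ⟨w, w', -, hw', -, h, -⟩ := c.exists_omega_eq hi hj
    rw [h]
    exact (hw'.blockCycle hi hj).property⟩

theorem exchange_involutive (hi : 1 ≤ i) (hj : 1 ≤ j) :
    Function.Involutive (exchange (i := i) (j := j) hi hj) := by
  intro c
  obtain ⟨w, w', -, -, -, h1, h2, -⟩ := c.exists_omega_eq hi hj
  apply Subtype.ext
  show omega i j (omega i j c.val) = c.val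
  rw [h1, h2]

theorem blueBlocks_eq_CE (hi : 1 ≤ i) (hj : 1 ≤ j) (c : BlockCycle i j) (T : NAT i j)
    (hT : T.blockCycle hi hj = c.exchange hi hj) :
    blueBlocks j c.val = CE j (T.excPerm hi hj).val := by
  obtain ⟨w, w', hw, hw', h1, h2, -, h3⟩ := c.exists_omega_eq hi hj
  have h4 : (blue j :: T.word).formPerm = (blue j :: w').formPerm :=
    (congrArg Subtype.val hT).trans h2
  have h5 := congrArg (cycleWord i j) h4
  rw [T.isBlockWord_word.cycleWord_eq hj, hw'.cycleWord_eq hj] at h5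
  obtain rfl := List.cons_inj_right _ |>.1 h5
  rw [T.CE_excPerm hi hj, ← h3, h1, hw.blueBlocks_eq hi hj]

end BlockCycle

/-! ### Equidistribution -/

theorem NAT.blueBlocks_blockCycle {i j : ℕ} (hi : 1 ≤ i) (hj : 1 ≤ j) (T : NAT i j) :
    blueBlocks j (T.blockCycle hi hj).val = T.hook := by
  rw [T.hook_eq]
  exact T.isBlockWord_word.blueBlocks_eq hi hj

theorem mainTheorem9 (i j : ℕ) (hi : 1 ≤ i) (hj : 1 ≤ j) :
    ∃ (Φ : NAT i j ≃ ExcPerm i j) (Ψ : NAT i j ≃ BlockCycle i j)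
      (ω : BlockCycle i j → BlockCycle i j),
      -- `Φ`, `Ψ` and `ω` are the two zigzag bijections and the block-swapping involution
      (∀ T u, (Φ T).val u = phi T u) ∧
      (∀ T e, (Ψ T).val e = psi T e) ∧
      (∀ c, (ω c).val = omega i j c.val) ∧
      Function.Involutive ω ∧
      -- blue blocks of `c` and the statistic of `Θ (ω c)`, where `Θ = Φ ∘ Ψ⁻¹`
      (∀ c, blueBlocks j c.val = CE j (Φ (Ψ.symm (ω c))).val) ∧
      -- equidistribution
      (∀ p : ℕ, Nat.card {T : NAT i j // T.hook = p} =
        Nat.card {π : ExcPerm i j // CE j π.val = p}) := by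
  let Φ := Equiv.ofBijective _ (NAT.excPerm_bijective hi hj)
  let Ψ := Equiv.ofBijective _ (NAT.blockCycle_bijective hi hj)
  have hstat : ∀ c : BlockCycle i j, blueBlocks j c.val = CE j (Φ (Ψ.symm (c.exchange hi hj))).val := fun c =>
    c.blueBlocks_eq_CE hi hj _ (Ψ.apply_symm_apply _)
  refine ⟨Φ, Ψ, BlockCycle.exchange hi hj, NAT.excPerm_apply hi hj, NAT.blockCycle_apply hi hj,
    fun _ => rfl, BlockCycle.exchange_involutive hi hj, hstat, fun p => ?_⟩
  let ω := (BlockCycle.exchange_involutive (i := i) (j := j) hi hj).toPerm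
  -- The bijection is `Φ ∘ Ψ⁻¹ ∘ ω ∘ Ψ`; hooks of `T` are blue blocks of `Ψ T`, which the previous
  -- identity converts into CE.
  refine Nat.card_congr ((((Ψ.trans ω).trans Ψ.symm).trans Φ).subtypeEquiv fun T => ?_)
  rw [← T.blueBlocks_blockCycle hi hj]
  exact (hstat (Ψ T)).congr_left
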